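/- **Model.** Let $(\Omega,\mathcal F,(\mathcal F_t)_{t\ge0},\mathbb P)$ be a filtered probability space with $\mathcal F_0$ $\mathbb P$-trivial, $P^0$ a càdlàg $(\mathcal F_t)$-martingale (unaffected price), $\gamma>0$, and let $h$ be an impact function (continuous, strictly increasing, $h(0)=0$, $x\mapsto xh(x)$ convex). Let $\alpha\in[0,1]$, $\kappa\ge0$. Orders of sizes $\widetilde Y_1,\widetilde Y_2,\ldots\in(0,\infty]$ arrive in a dark pool at random times $0<\tau_1<\tau_2<\cdots$; $N_t=\max\{k:\tau_k\le t\}$ (with $N_t=0$ if $\tau_1>t$) is a Poisson process with parameter $\theta>0$, the $\widetilde Y_i$ are i.i.d. with $\mathbb P[\widetilde Y_i\ge x]>0$ for all $x>0$, and the processes $P^0$, $N$, $(\widetilde Y_i)$ are independent. There is no slippage ($\beta=0$). For a dark-pool order of size $\widehat X\in\mathbb R$ with minimum quantity level $\Xi\in[0,|\widehat X|]$, the part of the $i$-th incoming order that is executed is $$Y_i=\operatorname{sgn}(\widehat X)\,\min\Big\{\widetilde Y_i,\ |\widehat X|-\sum_{j<i}|Y_j|\Big\}\ \text{ if }\widetilde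 Y_i\ge\Xi,\qquad Y_i=0\ \text{ otherwise.}$$ Put $Z_t=\sum_{i\le N_t}Y_i$, and let $(\mathcal G_t)$ be the right-continuous filtration generated by $(\mathcal F_t)$, $Z$ and $(\tau_i\wedge t)_{t\ge0}$, $i\ge1$. Assume that $P^0$ is also a $(\mathcal G_t)$-martingale, for every choice of $\widehat X$ and $\Xi$. **Strategies and costs.** Let $T>0$. A round trip is a quadruple $\chi=(\widehat X,\Xi,\xi,\rho)$ with $\widehat X\in\mathbb R$, $\Xi\in[0,|\widehat X|]$, a $(\mathcal G_t)$-stopping time $\rho<T$ a.s., and a $(\mathcal G_t)$-predictable process $\xi$, a.s. integrable on $[0,T]$, such that $\int_0^t\xi_s\,ds$ is a.s. bounded uniformly in $t\in[0,T]$ and $\omega$, and $\int_0^T\xi_t\,dt+Z_\rho=0$ a.s. Its costs are $$\mathcal C_T^\chi=\int_0^T\xi_tP_t^\chi\,dt+\alpha\gamma\int_0^TZ_{\rho\wedge t}\,\xi_t\,dt+\sum_{i=1}^{N_\rho}Y_i\Big(\widehat P^\chi_{\tau_i}+\alpha\gamma Z_{\tau_i-}\Big),$$ where $P^\chi_t=P^0_t+\gamma\int_0^t\xi_s\,ds+h(\xi_t)$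 and $\widehat P^\chi_{\tau_i}=P^0_{\tau_i}+\gamma\int_0^{\tau_i}\xi_s\,ds+\kappa h(\xi_{\tau_i})$; the costs are $+\infty$ when $\int_0^T\xi_th(\xi_t)\,dt=+\infty$. There is *price manipulation* for the horizon $T$ if there is a round trip $\chi$ whose expected costs exist in $[-\infty,\infty)$ and satisfy $\mathbb E[\mathcal C_T^\chi]<0$. **Proposition.** Suppose that $\kappa=0$ and $h(x)=\eta x$ for all $x$ (hence $\eta>0$). If $T\le\frac{2\eta}{\gamma}$, then there is no price manipulation for the horizon $T$. If moreover $\alpha=1$, then there is no price manipulation for the horizon $T$ if and only if $T\le\frac{2\eta}{\gamma}$. -/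

import Mathlib

open MeasureTheory ProbabilityTheory Filter Set Topology
open scoped NNReal ENNReal

noncomputable section

namespace DarkPool

/-- Impact functions: continuous, strictly increasing, vanishing at `0`, with `x ↦ x h(x)` convex. -/
structure IsImpactFunction (h : ℝ → ℝ) : Prop where
  continuous : Continuous h
  strictMono : StrictMono h
  map_zero : h 0 = 0
  convexOn : ConvexOn ℝ univ (fun x => x * h x)

/-- All paths of the process are right-continuous with left limits. -/
def IsCadlag {Ω : Type*} (S : ℝ≥0 → Ω → ℝ) : Prop :=
  ∀ ω t, ContinuousWithinAt (fun s => S s ω) (Ici t) t ∧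
    ∃ l : ℝ, Tendsto (fun s => S s ω) (𝓝[<] t) (𝓝 l)

/-- An Almgren--Chriss model `(γ, h, P⁰)` on the filtered probability space `(Ω, ℱ, P)`, together
with the parameters `(α, β, κ, (τ_i), (Ỹ_i))` of a dark-pool extension. Sequences are indexed
from `0`: `τ i` is the arrival time and `Ytil i` the size of the `(i+1)`-st matching order.
Slippage `β` is an impact function, or it is zero. -/
structure Model {Ω : Type*} [MeasurableSpace Ω] (P : Measure Ω) where
  ℱ : Filtration ℝ≥0 (inferInstance : MeasurableSpace Ω)
  /-- the `σ`-algebra `ℱ 0` is trivial -/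
  ℱ_zero : ∀ A, MeasurableSet[ℱ 0] A → P A = 0 ∨ P A = 1
  γ : ℝ
  γ_pos : 0 < γ
  h : ℝ → ℝ
  h_impact : IsImpactFunction h
  /-- the unaffected stock price -/
  P0 : ℝ≥0 → Ω → ℝ
  P0_martingale : Martingale P0 ℱ P
  P0_cadlag : IsCadlag P0
  α : ℝ
  α_mem : α ∈ Icc (0 : ℝ) 1
  β : ℝ → ℝ
  β_impact : IsImpactFunction β ∨ β = 0
  κ : ℝ
  κ_nonneg : 0 ≤ κ
  τ : ℕ → Ω → ℝ≥0
  τ_measurable : ∀ i, Measurable (τ i)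
  τ_pos : ∀ ω, 0 < τ 0 ω
  τ_strictMono : ∀ ω, StrictMono fun i => τ i ω
  /-- only finitely many orders arrive up to any finite time -/
  τ_tendsto : ∀ ω, Tendsto (fun i => τ i ω) atTop atTop
  Ytil : ℕ → Ω → ℝ≥0∞
  Ytil_measurable : ∀ i, Measurable (Ytil i)
  Ytil_pos : ∀ i ω, 0 < Ytil i ω

namespace Model

variable {Ω : Type*} [MeasurableSpace Ω] {P : Measure Ω} (M : Model P)

/-- The number of matching orders that have arrived up to time `t`. -/
def N (t : ℝ≥0) (ω : Ω) : ℕ := {i : ℕ | M.τ i ω ≤ t}.ncard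

/-- The total (unsigned) amount of the dark-pool order `Xhat`, with minimum quantity level `Xi`,
that is filled by the first `n` matching orders: an incoming order of size at least `Xi` is matched
up to the part of `|Xhat|` that is still unfilled. -/
def filled (Xhat Xi : ℝ) : ℕ → Ω → ℝ
  | 0, _ => 0
  | n + 1, ω => filled Xhat Xi n ω +
      if ENNReal.ofReal Xi ≤ M.Ytil n ω then
        (min (M.Ytil n ω) (ENNReal.ofReal (|Xhat| - filled Xhat Xi n ω))).toReal
      else 0

/-- The signed part `Y_{i+1}` of the `(i+1)`-st incoming order that is executed against `Xhat`. -/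
def Y (Xhat Xi : ℝ) (i : ℕ) (ω : Ω) : ℝ :=
  Real.sign Xhat * (M.filled Xhat Xi (i + 1) ω - M.filled Xhat Xi i ω)

/-- The number of shares executed in the dark pool until time `t` (without cancellation). -/
def Z (Xhat Xi : ℝ) (t : ℝ≥0) (ω : Ω) : ℝ := ∑ i ∈ Finset.range (M.N t ω), M.Y Xhat Xi i ω

lemma lt_N_iff (t : ℝ≥0) (ω : Ω) (i : ℕ) : i < M.N t ω ↔ M.τ i ω ≤ t := by
  have hfin : {i : ℕ | M.τ i ω ≤ t}.Finite := by
    obtain ⟨n, hn⟩ := ((M.τ_tendsto ω).eventually_gt_atTop t).exists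
    refine (Set.finite_Iio n).subset fun j hj => ?_
    by_contra hjn
    exact absurd (((M.τ_strictMono ω).monotone (not_lt.1 hjn)).trans hj) (not_le.2 hn)
  constructor
  · intro hi
    by_contra hc
    have hsub : {j : ℕ | M.τ j ω ≤ t} ⊆ Set.Iio i := by
      intro j hj
      by_contra hji
      exact hc (((M.τ_strictMono ω).monotone (not_lt.1 hji)).trans hj)
    have := Set.ncard_le_ncard hsub (Set.finite_Iio i)
    rw [show (Set.Iio i).ncard = i by simp [Set.ncard_eq_toFinset_card']] at this
    exact absurd hi (not_lt.2 this)
  · intro hi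
    have hsub : Set.Iic i ⊆ {j : ℕ | M.τ j ω ≤ t} := fun j hj =>
      ((M.τ_strictMono ω).monotone hj).trans hi
    have := Set.ncard_le_ncard hsub hfin
    rw [show (Set.Iic i).ncard = i + 1 by simp [Set.ncard_eq_toFinset_card']] at this
    exact this

lemma measurable_N (t : ℝ≥0) : Measurable (M.N t) := by
  refine measurable_of_Ioi fun i => ?_
  have : M.N t ⁻¹' Ioi i = {ω | M.τ i ω ≤ t} := by
    ext ω
    exact M.lt_N_iff t ω i
  rw [this]
  exact measurableSet_le (M.τ_measurable i) measurable_const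

lemma measurable_filled (Xhat Xi : ℝ) (n : ℕ) : Measurable (M.filled Xhat Xi n) := by
  induction n with
  | zero => exact measurable_const
  | succ n ih =>
    refine ih.add (Measurable.ite (measurableSet_le measurable_const (M.Ytil_measurable n)) ?_
      measurable_const)
    exact ((M.Ytil_measurable n).min (measurable_const.sub ih).ennreal_ofReal).ennreal_toReal

lemma measurable_Y (Xhat Xi : ℝ) (i : ℕ) : Measurable (M.Y Xhat Xi i) :=
  ((M.measurable_filled Xhat Xi (i + 1)).sub (M.measurable_filled Xhat Xi i)).const_mul _

lemma measurable_Z (Xhat Xi : ℝ) (t : ℝ≥0) : Measurable (M.Z Xhat Xi t) := by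
  have h : Measurable fun p : ℕ × Ω => ∑ i ∈ Finset.range p.1, M.Y Xhat Xi i p.2 :=
    measurable_from_prod_countable_right fun n =>
      Finset.measurable_sum (Finset.range n) fun i _ => M.measurable_Y Xhat Xi i
  exact h.comp ((M.measurable_N t).prodMk measurable_id)

/-- The filtration generated by `ℱ`, the process `Z` and the processes `(τ_i ∧ t)`. -/
def rawFiltration (Xhat Xi : ℝ) : Filtration ℝ≥0 (inferInstance : MeasurableSpace Ω) where
  seq t := M.ℱ t ⊔ ⨆ s : Iic t,
    (MeasurableSpace.comap (M.Z Xhat Xi s) inferInstance ⊔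
      ⨆ i : ℕ, MeasurableSpace.comap (fun ω => min (M.τ i ω) s) inferInstance)
  mono' := by
    intro s t hst
    refine sup_le_sup (M.ℱ.mono hst) (iSup_le fun u => ?_)
    exact le_iSup (fun s : Iic t => MeasurableSpace.comap (M.Z Xhat Xi s) inferInstance ⊔
      ⨆ i : ℕ, MeasurableSpace.comap (fun ω => min (M.τ i ω) s) inferInstance)
      ⟨u, u.2.trans hst⟩
  le' := by
    intro t
    refine sup_le (M.ℱ.le t) (iSup_le fun s => sup_le (M.measurable_Z Xhat Xi s).comap_le
      (iSup_le fun i => ((M.τ_measurable i).min measurable_const).comap_le))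

/-- The enlarged filtration `(𝒢_t)`: the right-continuous filtration generated by `ℱ`, `Z` and
`(τ_i ∧ t)`. Through `Z` it depends on the order `Xhat` and on the quantity level `Xi`. -/
def 𝒢 (Xhat Xi : ℝ) : Filtration ℝ≥0 (inferInstance : MeasurableSpace Ω) :=
  (M.rawFiltration Xhat Xi).rightCont

/-- The unaffected price is a martingale also under `(𝒢_t)`, for every dark-pool order. -/
def P0MartingaleEnlarged : Prop :=
  ∀ Xhat Xi : ℝ, 0 ≤ Xi → Xi ≤ |Xhat| → Martingale M.P0 (M.𝒢 Xhat Xi) P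

/-- `(N_t)` is a standard Poisson process with intensity `θ`. Monotonicity and right-continuity of
its paths, and `N 0 = 0`, hold by construction. -/
structure IsPoisson (θ : ℝ≥0) : Prop where
  indepIncrements : HasIndepIncrements (fun t ω => (M.N t ω : ℝ)) P
  increment_law : ∀ s t : ℝ≥0, s ≤ t →
    P.map (fun ω => M.N t ω - M.N s ω) = poissonMeasure (θ * (t - s))

/-- The matching orders arrive according to a Poisson process with parameter `θ`, their sizes are
i.i.d. with a common law `μ` of unbounded support in `(0,∞]`, and the processes `(P⁰_t)`, `(N_t)`,
`(Ỹ_i)` are independent. -/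
structure PoissonArrivals (θ : ℝ≥0) (μ : Measure ℝ≥0∞) : Prop where
  θ_pos : 0 < θ
  poisson : M.IsPoisson θ
  Ytil_indep : iIndepFun M.Ytil P
  Ytil_law : ∀ i, P.map (M.Ytil i) = μ
  μ_tail : ∀ x : ℝ, 0 < x → 0 < μ (Ici (ENNReal.ofReal x))
  indep : iIndep
    ![⨆ t, MeasurableSpace.comap (M.P0 t) inferInstance,
      ⨆ t, MeasurableSpace.comap (M.N t) inferInstance,
      ⨆ i, MeasurableSpace.comap (M.Ytil i) inferInstance] P

end Model

/-- A quadruple `(Xhat, Xi, ξ, ρ)`: size of the dark-pool order, minimum quantity level, trading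
speed at the exchange, cancellation time of the dark-pool order. -/
structure Strategy (Ω : Type*) where
  Xhat : ℝ
  Xi : ℝ
  ξ : ℝ≥0 → Ω → ℝ
  ρ : Ω → ℝ≥0

/-- The number of shares `∫_0^t ξ_s ds` bought at the exchange until time `t`. -/
def Strategy.exchange {Ω : Type*} (χ : Strategy Ω) (t : ℝ) (ω : Ω) : ℝ :=
  ∫ s in (0 : ℝ)..t, χ.ξ s.toNNReal ω

namespace Model

variable {Ω : Type*} [MeasurableSpace Ω] {P : Measure Ω} (M : Model P)

/-- Admissible trading strategies for the initial position `X₀` and the time horizon `T`. -/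
structure IsAdmissible (X₀ T : ℝ) (χ : Strategy Ω) : Prop where
  Xi_nonneg : 0 ≤ χ.Xi
  Xi_le : χ.Xi ≤ |χ.Xhat|
  ρ_stopping : IsStoppingTime (M.𝒢 χ.Xhat χ.Xi) (fun ω => (χ.ρ ω : WithTop ℝ≥0))
  ρ_lt : ∀ᵐ ω ∂P, (χ.ρ ω : ℝ) < T
  ξ_predictable : IsStronglyPredictable (M.𝒢 χ.Xhat χ.Xi) χ.ξ
  ξ_integrable : ∀ᵐ ω ∂P, IntervalIntegrable (fun t : ℝ => χ.ξ t.toNNReal ω) volume 0 T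
  exchange_bounded : ∃ C : ℝ, ∀ᵐ ω ∂P, ∀ t ∈ Icc (0 : ℝ) T, |χ.exchange t ω| ≤ C
  liquidation : ∀ᵐ ω ∂P, X₀ + χ.exchange T ω + M.Z χ.Xhat χ.Xi (χ.ρ ω) ω = 0

/-- The price of the asset at the exchange. -/
def exchangePrice (χ : Strategy Ω) (t : ℝ) (ω : Ω) : ℝ :=
  M.P0 t.toNNReal ω + M.γ * χ.exchange t ω + M.h (χ.ξ t.toNNReal ω)

/-- The price at which the `(i+1)`-st incoming order is executed in the dark pool. -/
def darkPrice (χ : Strategy Ω) (i : ℕ) (ω : Ω) : ℝ :=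
  M.P0 (M.τ i ω) ω + M.γ * χ.exchange (M.τ i ω) ω + M.κ * M.h (χ.ξ (M.τ i ω) ω)

/-- The costs of the strategy `χ`. The sum `∑ j < i, Y_{j+1}` is the left limit of `Z` at the
arrival time of the `(i+1)`-st incoming order. -/
def cost (X₀ T : ℝ) (χ : Strategy Ω) (ω : Ω) : ℝ :=
  X₀ * M.P0 0 ω
  + (∫ t in (0 : ℝ)..T, χ.ξ t.toNNReal ω * M.exchangePrice χ t ω)
  + M.α * M.γ *
      (∫ t in (0 : ℝ)..T, M.Z χ.Xhat χ.Xi (min (χ.ρ ω) t.toNNReal) ω * χ.ξ t.toNNReal ω)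
  + ∑ i ∈ Finset.range (M.N (χ.ρ ω) ω), M.Y χ.Xhat χ.Xi i ω *
      (M.darkPrice χ i ω
        + M.α * M.γ * (∑ j ∈ Finset.range i, M.Y χ.Xhat χ.Xi j ω)
        + M.β (M.Y χ.Xhat χ.Xi i ω))

/-- The expected costs are strictly negative, `𝔼[C_T] ∈ [-∞, 0)`. This requires that almost surely
the integral `∫_0^T ξ_t P^χ_t dt` converges: since `x h(x) ≥ 0`, this integral, and hence the costs,
are otherwise `+∞`. For the real-valued costs, it then says `𝔼[C_T⁺] < 𝔼[C_T⁻]`. -/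
def HasNegativeExpectedCosts (X₀ T : ℝ) (χ : Strategy Ω) : Prop :=
  (∀ᵐ ω ∂P, IntervalIntegrable
    (fun t : ℝ => χ.ξ t.toNNReal ω * M.exchangePrice χ t ω) volume 0 T) ∧
  ∫⁻ ω, ENNReal.ofReal (M.cost X₀ T χ ω) ∂P < ∫⁻ ω, ENNReal.ofReal (-M.cost X₀ T χ ω) ∂P

/-- A price manipulation strategy for the horizon `T` is a round trip, that is an admissible
strategy with `X₀ = 0`, whose expected costs are strictly negative. -/
def HasPriceManipulation (T : ℝ) : Prop :=
  ∃ χ : Strategy Ω, M.IsAdmissible 0 T χ ∧ M.HasNegativeExpectedCosts 0 T χ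

end Model

end DarkPool

end

/-! Write x_t for the shares bought at the exchange up to time t, z = Z_ρ and S = ∫ξ². Since x_T =
-z, the costs split (`cost_eq`) into the costs A of trading at the unaffected price and an impact
part, which is the mixture with weights 1-α and α of ηS + γz²/2 + γ∑Y_i x_{τ_i} and ηS - (γ/2)∑Y_i².

Cauchy–Schwarz on [0,u] and on [u,T] gives x_u² + (z+x_u)² ≤ TS. The Y_i share one sign, so ∑Y_i² ≤
z² ≤ TS. Hence both parts of the mixture are nonnegative when γT ≤ 2η (`impactCost_nonneg`), and the
costs dominate A pathwise. It remains to see that A has mean zero whenever its mean exists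
(`IsAdmissible.lintegral_unaffectedCost`).

Summation by parts exhibits -A as an almost sure limit of discrete integrals of the position, which
is uniformly bounded, against P⁰. As P⁰ is merely an integrable martingale, there is no isometry,
and A need not be integrable. Burkholder's function supplies a bound on a truncated second moment of
1/2 + aL for each such integral L (`IsDiscreteIntegral.integral_min_le`). The bound survives the
limit, and its first-order expansion as a → 0 yields E L⁺ ≤ E L⁻; applied to L and -L this gives
equality.

For α = 1 the estimates are nearly attained by an all-or-nothing order of one share, cancelled at a
small time δ and sold off at a constant rate: the impact part is (η/(T-δ) - γ/2) Z_δ. This has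
negative mean for small δ > 0 once T > 2η/γ. Here the position has bounded variation, so A is
integrable (`integral_abs_sum_le` and Fatou). -/

noncomputable section

namespace DarkPool

/-! ### Burkholder's function -/

/-- Burkholder's function for the weak-type inequality for martingale transforms. -/
def burkholder (x y : ℝ) : ℝ := if |x| + |y| ≤ 1 then y ^ 2 - x ^ 2 else 1 - 2 * |x|

/-- The slope of `burkholder` in its first argument. -/
def burkholderFst (x y : ℝ) : ℝ :=
  if |x| + |y| ≤ 1 then -(2 * x) else if 0 ≤ x then -2 else 2

/-- The slope of `burkholder` in its second argument. -/
def burkholderSnd (x y : ℝ) : ℝ := if |x| + |y| ≤ 1 then 2 * y else 0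

lemma burkholder_le_one_sub (x y : ℝ) : burkholder x y ≤ 1 - 2 * |x| := by
  unfold burkholder
  split_ifs with h
  · have h1 : |y| ^ 2 ≤ (1 - |x|) ^ 2 :=
      pow_le_pow_left₀ (abs_nonneg y) (by linarith) 2
    rw [← sq_abs y, ← sq_abs x]
    nlinarith
  · exact le_rfl

/-- Inside the diamond, the expansion of y² - x² leaves the remainder k² - h² ≤ 0. Outside, 1 - 2|x|
is concave and majorizes the function everywhere. Taking means, this makes the function decrease
along a martingale and a transform with smaller increments. -/
lemma burkholder_step {x y h k : ℝ} (hk : |k| ≤ |h|) :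
    burkholder (x + h) (y + k)
      ≤ burkholder x y + burkholderFst x y * h + burkholderSnd x y * k := by
  have hsq : k ^ 2 ≤ h ^ 2 := sq_le_sq.2 hk
  by_cases hD : |x| + |y| ≤ 1
  · have hR : burkholder x y + burkholderFst x y * h + burkholderSnd x y * k
        = (y + k) ^ 2 - (x + h) ^ 2 + (h ^ 2 - k ^ 2) := by
      simp only [burkholder, burkholderFst, burkholderSnd, if_pos hD]; ring
    rw [hR]
    by_cases hD' : |x + h| + |y + k| ≤ 1
    · simp only [burkholder, if_pos hD']; linarith
    · simp only [burkholder, if_neg hD']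
      have hx' : |x + h| ^ 2 = (x + h) ^ 2 := sq_abs _
      rcases le_or_gt |x + h| 1 with h1 | h1
      · have : (1 - |x + h|) ^ 2 ≤ |y + k| ^ 2 :=
          pow_le_pow_left₀ (by linarith) (by linarith) 2
        rw [sq_abs] at this
        nlinarith
      -- The jump crosses |x| = 1. With w = 1 - x or w = 1 + x, according to the side, the gap is at
      -- least (w - |y|)(2|h| - w - |y|), and |h| ≥ w ≥ |y|.
      · have hyk : -(|y| * |h|) ≤ y * k := by
          have h2 := neg_abs_le (y * k)
          rw [abs_mul] at h2
          have := mul_le_mul_of_nonneg_left hk (abs_nonneg y)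
          linarith
        have hy2 : |y| ^ 2 = y ^ 2 := sq_abs _
        have hy0 := abs_nonneg y
        rcases abs_cases (x + h) with ⟨e, -⟩ | ⟨e, -⟩ <;> rw [e] at h1 ⊢
        · have hx := le_abs_self x
          have hh : |h| = h := abs_of_nonneg (by linarith)
          rw [hh] at hyk
          nlinarith [mul_nonneg (show 0 ≤ h - (1 - x) by linarith)
            (show 0 ≤ 1 - x - |y| by linarith), sq_nonneg (1 - x - |y|)]
        · have hx := neg_abs_le x
          have hh : |h| = -h := abs_of_nonpos (by linarith)
          rw [hh] at hyk
          nlinarith [mul_nonneg (show 0 ≤ -h - (1 + x) by linarith)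
            (show 0 ≤ 1 + x - |y| by linarith), sq_nonneg (1 + x - |y|)]
  · have h1 := burkholder_le_one_sub (x + h) (y + k)
    refine h1.trans ?_
    simp only [burkholder, burkholderFst, burkholderSnd, if_neg hD]
    split_ifs with hx
    · rw [abs_of_nonneg hx]
      linarith [le_abs_self (x + h)]
    · rw [abs_of_neg (not_le.1 hx)]
      linarith [neg_abs_le (x + h)]

lemma burkholder_start (x y : ℝ) : burkholder x y ≤ y ^ 2 := by
  unfold burkholder
  split_ifs with h
  · nlinarith [sq_nonneg x]
  · rw [← sq_abs y]
    nlinarith [sq_nonneg (1 - |y|)]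

/-- The level 1/2 comes from outside the diamond, where 1 - 2|x| + 2x² = 1/2 + (2|x| - 1)²/2. -/
lemma min_sq_le_burkholder (x y : ℝ) :
    min (y ^ 2) (1 / 2) ≤ burkholder x y + 2 * min (x ^ 2) |x| := by
  have hx := abs_nonneg x
  have hx2 : |x| ^ 2 = x ^ 2 := sq_abs x
  unfold burkholder
  split_ifs with h
  · have h1 : |x| ≤ 1 := by linarith [abs_nonneg y]
    rw [min_eq_left (show x ^ 2 ≤ |x| by nlinarith)]
    exact (min_le_left _ _).trans (by nlinarith)
  · refine (min_le_right _ _).trans ?_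
    rcases min_cases (x ^ 2) |x| with ⟨e, -⟩ | ⟨e, -⟩ <;> rw [e]
    · nlinarith [sq_nonneg (2 * |x| - 1)]
    · linarith

lemma abs_burkholder_le (x y : ℝ) : |burkholder x y| ≤ 1 + 2 * |x| := by
  have hx := abs_nonneg x
  refine abs_le.2 ⟨?_, (burkholder_le_one_sub x y).trans (by linarith)⟩
  have h1 := min_sq_le_burkholder x y
  have h2 : 0 ≤ min (y ^ 2) (1 / 2) := le_min (sq_nonneg y) (by norm_num)
  have h3 := min_le_right (x ^ 2) |x|
  linarith

lemma abs_burkholderFst_le (x y : ℝ) : |burkholderFst x y| ≤ 2 := by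
  unfold burkholderFst
  split_ifs with h h'
  · rw [abs_neg, abs_mul, abs_two]; linarith [abs_nonneg y]
  · simp
  · simp

lemma abs_burkholderSnd_le (x y : ℝ) : |burkholderSnd x y| ≤ 2 := by
  unfold burkholderSnd
  split_ifs with h
  · rw [abs_mul, abs_two]; linarith [abs_nonneg x]
  · simp

lemma measurableSet_diamond : MeasurableSet {p : ℝ × ℝ | |p.1| + |p.2| ≤ 1} :=
  measurableSet_le (by fun_prop) (by fun_prop)

lemma measurable_burkholder : Measurable fun p : ℝ × ℝ => burkholder p.1 p.2 :=
  Measurable.ite measurableSet_diamond (by fun_prop) (by fun_prop)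

lemma measurable_burkholderFst : Measurable fun p : ℝ × ℝ => burkholderFst p.1 p.2 :=
  Measurable.ite measurableSet_diamond (by fun_prop)
    (Measurable.ite (measurableSet_le measurable_const measurable_fst) measurable_const
      measurable_const)

lemma measurable_burkholderSnd : Measurable fun p : ℝ × ℝ => burkholderSnd p.1 p.2 :=
  Measurable.ite measurableSet_diamond (by fun_prop) measurable_const

/-! ### Discrete martingale transforms -/

section Transform

variable {Ω ι : Type*} [MeasurableSpace Ω] {P : Measure Ω} [Preorder ι]
  {𝒢 : Filtration ι (inferInstance : MeasurableSpace Ω)} {M : ι → Ω → ℝ}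

lemma integral_mul_martingale_sub [IsFiniteMeasure P] (hM : Martingale M 𝒢 P) {s t : ι}
    (hst : s ≤ t) {K : Ω → ℝ} (hK : StronglyMeasurable[𝒢 s] K) {c : ℝ} (hc : ∀ ω, |K ω| ≤ c) :
    Integrable (fun ω => K ω * (M t ω - M s ω)) P ∧ ∫ ω, K ω * (M t ω - M s ω) ∂P = 0 := by
  have hint : Integrable (M t - M s) P := (hM.integrable t).sub (hM.integrable s)
  have hKi : Integrable (K * (M t - M s)) P :=
    hint.bdd_mul (hK.mono (𝒢.le s)).aestronglyMeasurable (c := c)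
      (ae_of_all _ fun ω => by rw [Real.norm_eq_abs]; exact hc ω)
  refine ⟨hKi, ?_⟩
  have h1 : P[K * (M t - M s)|𝒢 s] =ᵐ[P] 0 := by
    have h2 := condExp_mul_of_stronglyMeasurable_left hK hKi hint
    have h3 : P[M t - M s|𝒢 s] =ᵐ[P] 0 := by
      have h4 := condExp_sub (hM.integrable t) (hM.integrable s) (𝒢 s)
      filter_upwards [h4, hM.2 s t hst, hM.2 s s le_rfl] with ω a b c
      rw [a, Pi.sub_apply, b, c, sub_self, Pi.zero_apply]
    filter_upwards [h2, h3] with ω a b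
    rw [a, Pi.mul_apply, b, Pi.zero_apply, mul_zero]
  have h5 := integral_condExp (μ := P) (𝒢.le s) (f := K * (M t - M s))
  rw [integral_congr_ae h1] at h5
  simpa using h5.symm

/-- A discrete stochastic integral with respect to `M`, up to time `T`, of an integrand bounded
by `C`. -/
structure IsDiscreteIntegral (𝒢 : Filtration ι (inferInstance : MeasurableSpace Ω))
    (M : ι → Ω → ℝ) (T : ι) (C : ℝ) (L : Ω → ℝ) : Prop where
  exists_eq : ∃ (n : ℕ) (t : ℕ → ι) (H : ℕ → Ω → ℝ), Monotone t ∧ t n = T ∧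
    (∀ k, StronglyMeasurable[𝒢 (t k)] (H k)) ∧ (∀ k ω, |H k ω| ≤ C) ∧
    ∀ ω, L ω = ∑ k ∈ Finset.range n, H k ω * (M (t (k + 1)) ω - M (t k) ω)

lemma IsDiscreteIntegral.neg {T : ι} {C : ℝ} {L : Ω → ℝ} (h : IsDiscreteIntegral 𝒢 M T C L) :
    IsDiscreteIntegral 𝒢 M T C (-L) := by
  obtain ⟨n, t, H, ht, htn, hH, hC, hL⟩ := h.exists_eq
  refine ⟨n, t, -H, ht, htn, fun k => (hH k).neg, fun k ω => ?_, fun ω => ?_⟩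
  · simpa using hC k ω
  · simp [hL, Finset.sum_neg_distrib]

lemma IsDiscreteIntegral.measurable (hM : Martingale M 𝒢 P) {T : ι} {C : ℝ} {L : Ω → ℝ}
    (h : IsDiscreteIntegral 𝒢 M T C L) : Measurable L := by
  obtain ⟨n, t, H, ht, htn, hH, hC, hL⟩ := h.exists_eq
  rw [funext hL]
  exact Finset.measurable_sum _ fun k _ => ((hH k).mono (𝒢.le _)).measurable.mul
    (((hM.1 _).mono (𝒢.le _)).measurable.sub ((hM.1 _).mono (𝒢.le _)).measurable)

/-- Burkholder's function is evaluated along X = aCM and Y = 1/2 + a·(partial integral). The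
increments of Y are dominated by those of X because |H| ≤ C, so the means decrease; they start below
(1/2)² = 1/4. -/
lemma IsDiscreteIntegral.integral_min_le [IsProbabilityMeasure P] (hM : Martingale M 𝒢 P) {T : ι}
    {C : ℝ} {L : Ω → ℝ} (h : IsDiscreteIntegral 𝒢 M T C L) {a : ℝ} (ha : 0 ≤ a) (hC0 : 0 ≤ C) :
    ∫ ω, min ((1 / 2 + a * L ω) ^ 2) (1 / 2) ∂P
      ≤ 1 / 4 + 2 * ∫ ω, min ((a * C * M T ω) ^ 2) |a * C * M T ω| ∂P := by
  obtain ⟨n, t, H, ht, rfl, hH, hC, hL⟩ := h.exists_eq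
  set X : ℕ → Ω → ℝ := fun k ω => a * C * M (t k) ω with hX
  set Y : ℕ → Ω → ℝ := fun k ω =>
    1 / 2 + a * ∑ j ∈ Finset.range k, H j ω * (M (t (j + 1)) ω - M (t j) ω) with hY
  have hXm : ∀ k, Measurable[𝒢 (t k)] (X k) := fun k => (hM.1 (t k)).measurable.const_mul _
  have hYm : ∀ k, Measurable[𝒢 (t k)] (Y k) := by
    intro k
    refine Measurable.const_add (Measurable.const_mul (Finset.measurable_sum _ fun j hj => ?_) _) _
    have hjk := Finset.mem_range.1 hj
    exact ((hH j).mono (𝒢.mono (ht hjk.le))).measurable.mul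
      (((hM.1 _).mono (𝒢.mono (ht hjk))).measurable.sub
        ((hM.1 _).mono (𝒢.mono (ht hjk.le))).measurable)
  have hXi : ∀ k, Integrable (X k) P := fun k => (hM.integrable (t k)).const_mul _
  have hUi : ∀ k, Integrable (fun ω => burkholder (X k ω) (Y k ω)) P := by
    intro k
    refine Integrable.mono' ((integrable_const (1 : ℝ)).add ((hXi k).abs.const_mul 2)) ?_
      (ae_of_all _ fun ω => ?_)
    · exact (measurable_burkholder.comp (((hXm k).mono (𝒢.le _) le_rfl).prodMk
        ((hYm k).mono (𝒢.le _) le_rfl))).aestronglyMeasurable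
    · rw [Real.norm_eq_abs]; exact abs_burkholder_le _ _
  have hstep : ∀ k, ∫ ω, burkholder (X (k + 1) ω) (Y (k + 1) ω) ∂P
      ≤ ∫ ω, burkholder (X k ω) (Y k ω) ∂P := by
    intro k
    -- K collects the two linear terms of `burkholder_step`. It is bounded and known at time t k, so
    -- its product with the martingale increment has mean zero.
    set K : Ω → ℝ := fun ω => burkholderFst (X k ω) (Y k ω) * (a * C)
      + burkholderSnd (X k ω) (Y k ω) * (a * H k ω) with hK
    have hKm : Measurable[𝒢 (t k)] K :=
      ((measurable_burkholderFst.comp ((hXm k).prodMk (hYm k))).mul_const _).add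
        ((measurable_burkholderSnd.comp ((hXm k).prodMk (hYm k))).mul
          ((hH k).measurable.const_mul a))
    have hKb : ∀ ω, |K ω| ≤ 2 * (a * C) + 2 * (a * C) := by
      intro ω
      refine (abs_add_le _ _).trans (add_le_add ?_ ?_)
      · rw [abs_mul, abs_of_nonneg (mul_nonneg ha hC0)]
        exact mul_le_mul_of_nonneg_right (abs_burkholderFst_le _ _) (mul_nonneg ha hC0)
      · rw [abs_mul, abs_mul, abs_of_nonneg ha]
        exact mul_le_mul (abs_burkholderSnd_le _ _)
          (mul_le_mul_of_nonneg_left (hC k ω) ha) (by positivity) (by norm_num)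
    obtain ⟨h1, h2⟩ := integral_mul_martingale_sub hM (ht (Nat.le_succ k))
      (Measurable.stronglyMeasurable hKm) hKb
    calc ∫ ω, burkholder (X (k + 1) ω) (Y (k + 1) ω) ∂P
        ≤ ∫ ω, (burkholder (X k ω) (Y k ω) + K ω * (M (t (k + 1)) ω - M (t k) ω)) ∂P := by
          refine integral_mono (hUi _) ((hUi k).add h1) fun ω => ?_
          have h3 := burkholder_step (x := X k ω) (y := Y k ω)
            (h := a * C * (M (t (k + 1)) ω - M (t k) ω))
            (k := a * (H k ω * (M (t (k + 1)) ω - M (t k) ω))) (by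
              rw [abs_mul, abs_mul, abs_mul, abs_of_nonneg ha,
                abs_of_nonneg (mul_nonneg ha hC0), mul_assoc]
              exact mul_le_mul_of_nonneg_left
                (mul_le_mul_of_nonneg_right (hC k ω) (abs_nonneg _)) ha)
          have e1 : X (k + 1) ω = X k ω + a * C * (M (t (k + 1)) ω - M (t k) ω) := by
            simp only [hX]; ring
          have e2 : Y (k + 1) ω = Y k ω + a * (H k ω * (M (t (k + 1)) ω - M (t k) ω)) := by
            simp only [hY, Finset.sum_range_succ]; ring
          simp only [e1, e2]
          refine h3.trans (le_of_eq ?_)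
          simp only [hK]; ring
      _ = _ := by rw [integral_add (hUi k) h1, h2, add_zero]
  have hanti : ∀ k, ∫ ω, burkholder (X k ω) (Y k ω) ∂P ≤ 1 / 4 := by
    intro k
    induction k with
    | zero =>
      refine (integral_mono (hUi 0) (integrable_const (1 / 4 : ℝ)) fun ω => ?_).trans (by simp)
      have : Y 0 ω = 1 / 2 := by simp [hY]
      simp only [this]
      refine (burkholder_start _ _).trans (by norm_num)
    | succ k ih => exact (hstep k).trans ih
  have hmi : Integrable (fun ω => min ((a * C * M (t n) ω) ^ 2) |a * C * M (t n) ω|) P := by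
    refine Integrable.mono' (hXi n).abs ?_ (ae_of_all _ fun ω => ?_)
    · have := ((hXm n).mono (𝒢.le _) le_rfl)
      exact ((this.pow_const 2).min (measurable_abs.comp this)).aestronglyMeasurable
    · rw [Real.norm_eq_abs, abs_of_nonneg (le_min (sq_nonneg _) (abs_nonneg _))]
      exact min_le_right _ _
  calc ∫ ω, min ((1 / 2 + a * L ω) ^ 2) (1 / 2) ∂P
      ≤ ∫ ω, (burkholder (X n ω) (Y n ω)
          + 2 * min ((a * C * M (t n) ω) ^ 2) |a * C * M (t n) ω|) ∂P := by
        refine integral_mono_of_nonneg (ae_of_all _ fun ω => le_min (sq_nonneg _) (by norm_num))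
          ((hUi n).add (hmi.const_mul 2)) (ae_of_all _ fun ω => ?_)
        have := min_sq_le_burkholder (X n ω) (Y n ω)
        simp only [hL]
        exact this
    _ = ∫ ω, burkholder (X n ω) (Y n ω) ∂P
          + 2 * ∫ ω, min ((a * C * M (t n) ω) ^ 2) |a * C * M (t n) ω| ∂P := by
        rw [integral_add (hUi n) (hmi.const_mul 2), integral_const_mul]
    _ ≤ _ := by linarith [hanti n]

end Transform

/-! ### Means of limits of discrete stochastic integrals -/

section Limit

variable {Ω ι : Type*} [MeasurableSpace Ω] {P : Measure Ω} [Preorder ι]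
  {𝒢 : Filtration ι (inferInstance : MeasurableSpace Ω)} {M : ι → Ω → ℝ}

lemma integral_min_le_of_tendsto [IsProbabilityMeasure P] (hM : Martingale M 𝒢 P) {T : ι} {C : ℝ}
    (hC : 0 ≤ C) {L : Ω → ℝ} {A : ℕ → Ω → ℝ} (hA : ∀ n, IsDiscreteIntegral 𝒢 M T C (A n))
    (hL : ∀ᵐ ω ∂P, Tendsto (fun n => A n ω) atTop (𝓝 (L ω))) {a : ℝ} (ha : 0 ≤ a) :
    ∫ ω, min ((1 / 2 + a * L ω) ^ 2) (1 / 2) ∂P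
      ≤ 1 / 4 + 2 * ∫ ω, min ((a * C * M T ω) ^ 2) |a * C * M T ω| ∂P := by
  refine le_of_tendsto (tendsto_integral_of_dominated_convergence (fun _ => (1 / 2 : ℝ))
    (F := fun n ω => min ((1 / 2 + a * A n ω) ^ 2) (1 / 2)) (fun n => ?_) (integrable_const _)
    (fun n => ae_of_all _ fun ω => ?_) ?_) (Eventually.of_forall fun n =>
      (hA n).integral_min_le hM ha hC)
  · exact (((((hA n).measurable hM).const_mul a).const_add _).pow_const 2 |>.min
      measurable_const).aestronglyMeasurable
  · rw [Real.norm_eq_abs, abs_of_nonneg (le_min (sq_nonneg _) (by norm_num))]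
    exact min_le_right _ _
  · filter_upwards [hL] with ω hω
    exact (((hω.const_mul a).const_add _).pow 2).min tendsto_const_nhds

/-- An almost sure limit of discrete stochastic integrals of uniformly bounded integrands with
respect to a martingale cannot have a strictly positive mean in `[-∞, ∞]`. -/
lemma lintegral_pos_part_le_of_tendsto [IsProbabilityMeasure P] (hM : Martingale M 𝒢 P) {T : ι}
    {C : ℝ} (hC : 0 ≤ C) {L : Ω → ℝ} {A : ℕ → Ω → ℝ}
    (hA : ∀ n, IsDiscreteIntegral 𝒢 M T C (A n))
    (hL : ∀ᵐ ω ∂P, Tendsto (fun n => A n ω) atTop (𝓝 (L ω))) :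
    ∫⁻ ω, ENNReal.ofReal (L ω) ∂P ≤ ∫⁻ ω, ENNReal.ofReal (-L ω) ∂P := by
  by_cases hfin : ∫⁻ ω, ENNReal.ofReal (-L ω) ∂P = ∞
  · rw [hfin]; exact le_top
  have hLm : AEMeasurable L P :=
    aemeasurable_of_tendsto_metrizable_ae' (fun n => ((hA n).measurable hM).aemeasurable) hL
  have hMm : AEMeasurable (M T) P := (hM.integrable T).aestronglyMeasurable.aemeasurable
  have hneg : Integrable (fun ω => max (-L ω) 0) P := by
    refine ⟨(hLm.neg.max aemeasurable_const).aestronglyMeasurable, ?_⟩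
    rw [hasFiniteIntegral_iff_ofReal (ae_of_all _ fun ω => le_max_right (-L ω) 0)]
    simpa only [ENNReal.ofReal_max, ENNReal.ofReal_zero, max_eq_left zero_le] using
      lt_top_iff_ne_top.2 hfin
  have hneg' : ∫⁻ ω, ENNReal.ofReal (-L ω) ∂P = ENNReal.ofReal (∫ ω, max (-L ω) 0 ∂P) := by
    rw [ofReal_integral_eq_lintegral_ofReal hneg (ae_of_all _ fun ω => le_max_right _ _)]
    simp only [ENNReal.ofReal_max, ENNReal.ofReal_zero, max_eq_left zero_le]
  set a : ℕ → ℝ := fun m => 1 / ((m : ℝ) + 1) with hadef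
  have ha : ∀ m, 0 < a m := fun m => Nat.one_div_pos_of_nat
  have hat : Tendsto a atTop (𝓝 0) := tendsto_one_div_add_atTop_nhds_zero_nat
  -- The error term of the weak-type bound divided by a. It vanishes as a → 0 by dominated
  -- convergence, with C|M_T| as dominating function; this uses only integrability of the
  -- martingale.
  set R : ℕ → ℝ := fun m => ∫ ω, min (a m * C ^ 2 * M T ω ^ 2) (C * |M T ω|) ∂P with hR
  have hR0 : Tendsto R atTop (𝓝 0) := by
    have : (0 : ℝ) = ∫ _, (0 : ℝ) ∂P := by simp
    rw [this]
    refine tendsto_integral_of_dominated_convergence (fun ω => C * |M T ω|) (fun m => ?_)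
      ((hM.integrable T).abs.const_mul C) (fun m => ae_of_all _ fun ω => ?_)
      (ae_of_all _ fun ω => ?_)
    · exact (((hMm.pow_const 2).const_mul _).min
        ((measurable_abs.comp_aemeasurable hMm).const_mul C)).aestronglyMeasurable
    · have := ha m
      rw [Real.norm_eq_abs, abs_of_nonneg (le_min (by positivity) (by positivity))]
      exact min_le_right _ _
    · have h1 : Tendsto (fun m => a m * C ^ 2 * M T ω ^ 2) atTop (𝓝 0) := by
        simpa using (hat.mul_const (C ^ 2)).mul_const (M T ω ^ 2)
      have h2 := h1.min (tendsto_const_nhds (x := C * |M T ω|))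
      rwa [min_eq_left (by positivity)] at h2
  -- The truncation level 1/(4a) is chosen so that 1/4 + aF stays below the cap 1/2.
  set F : ℕ → Ω → ℝ := fun m ω => min (max (L ω) 0) (1 / (4 * a m)) with hF
  have hFb : ∀ m ω, 0 ≤ F m ω ∧ F m ω ≤ 1 / (4 * a m) := fun m ω =>
    ⟨le_min (le_max_right _ _) (by have := ha m; positivity), min_le_right _ _⟩
  have hFm : ∀ m, AEMeasurable (F m) P := fun m =>
    (hLm.max aemeasurable_const).min aemeasurable_const
  have hFi : ∀ m, Integrable (F m) P := fun m =>
    Integrable.mono' (integrable_const (1 / (4 * a m))) (hFm m).aestronglyMeasurable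
      (ae_of_all _ fun ω => by
        rw [Real.norm_eq_abs, abs_of_nonneg (hFb m ω).1]; exact (hFb m ω).2)
  have hbound : ∀ m, ∫ ω, F m ω ∂P ≤ ∫ ω, max (-L ω) 0 ∂P + 2 * R m := by
    intro m
    have hm := ha m
    have h1 := integral_min_le_of_tendsto hM hC hA hL hm.le
    -- Pointwise, (1/2 + aL)² ≥ 1/4 + aL. The constants 1/4 will cancel against the weak-type bound,
    -- leaving terms of order a.
    have h2 : ∫ ω, (1 / 4 + a m * F m ω - a m * max (-L ω) 0) ∂P
        ≤ ∫ ω, min ((1 / 2 + a m * L ω) ^ 2) (1 / 2) ∂P := by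
      refine integral_mono (((integrable_const _).add ((hFi m).const_mul _)).sub (hneg.const_mul _)) ?_
        fun ω => ?_
      · refine Integrable.mono' (integrable_const (1 / 2 : ℝ))
          ((((hLm.const_mul _).const_add _).pow_const 2).min
            aemeasurable_const).aestronglyMeasurable (ae_of_all _ fun ω => ?_)
        rw [Real.norm_eq_abs, abs_of_nonneg (le_min (sq_nonneg _) (by norm_num))]
        exact min_le_right _ _
      · have hF1 : a m * F m ω ≤ a m * max (L ω) 0 :=
          mul_le_mul_of_nonneg_left (min_le_left _ _) hm.le
        have hF2 : a m * F m ω ≤ 1 / 4 := by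
          refine (mul_le_mul_of_nonneg_left (hFb m ω).2 hm.le).trans (le_of_eq ?_)
          field_simp
        have hn : 0 ≤ a m * max (-L ω) 0 := mul_nonneg hm.le (le_max_right _ _)
        refine le_min ?_ (by linarith)
        have hmax : a m * max (L ω) 0 - a m * max (-L ω) 0 = a m * L ω := by
          rw [← mul_sub, max_zero_sub_max_neg_zero_eq_self]
        nlinarith [sq_nonneg (a m * L ω)]
    have hFi' : Integrable (fun ω => 1 / 4 + a m * F m ω) P :=
      (integrable_const _).add ((hFi m).const_mul _)
    have h3 : ∫ ω, (1 / 4 + a m * F m ω - a m * max (-L ω) 0) ∂P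
        = 1 / 4 + a m * ∫ ω, F m ω ∂P - a m * ∫ ω, max (-L ω) 0 ∂P := by
      rw [integral_sub hFi' (hneg.const_mul _),
        integral_add (integrable_const _) ((hFi m).const_mul _), integral_const_mul,
        integral_const_mul]
      simp
    have h4 : ∫ ω, min ((a m * C * M T ω) ^ 2) |a m * C * M T ω| ∂P = a m * R m := by
      rw [hR, ← integral_const_mul]
      refine integral_congr_ae (ae_of_all _ fun ω => ?_)
      simp only
      rw [abs_mul, abs_of_nonneg (mul_nonneg hm.le hC), mul_min_of_nonneg _ _ hm.le]
      congr 1 <;> ring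
    rw [h3] at h2
    rw [h4] at h1
    have h5 : a m * ∫ ω, F m ω ∂P ≤ a m * (∫ ω, max (-L ω) 0 ∂P + 2 * R m) := by linarith
    exact le_of_mul_le_mul_left h5 hm
  have hpt : ∀ ω, Tendsto (fun m => ENNReal.ofReal (F m ω)) atTop (𝓝 (ENNReal.ofReal (L ω))) := by
    intro ω
    have h1 : Tendsto (fun m => F m ω) atTop (𝓝 (max (L ω) 0)) := by
      refine tendsto_const_nhds.congr' ?_
      obtain ⟨m₀, hm₀⟩ := exists_nat_ge (4 * max (L ω) 0)
      filter_upwards [eventually_ge_atTop m₀] with m hm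
      have : (m₀ : ℝ) ≤ m := by exact_mod_cast hm
      refine (min_eq_left ?_).symm
      simp only [hadef]
      rw [show 1 / (4 * (1 / ((m : ℝ) + 1))) = ((m : ℝ) + 1) / 4 by field_simp]
      linarith
    have h2 := (ENNReal.continuous_ofReal.tendsto _).comp h1
    simpa only [Function.comp_def, ENNReal.ofReal_max, ENNReal.ofReal_zero,
      max_eq_left zero_le] using h2
  calc ∫⁻ ω, ENNReal.ofReal (L ω) ∂P
      = ∫⁻ ω, liminf (fun m => ENNReal.ofReal (F m ω)) atTop ∂P :=
        lintegral_congr fun ω => (hpt ω).liminf_eq.symm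
    _ ≤ liminf (fun m => ∫⁻ ω, ENNReal.ofReal (F m ω) ∂P) atTop :=
        lintegral_liminf_le' fun m => (hFm m).ennreal_ofReal
    _ ≤ liminf (fun m => ENNReal.ofReal (∫ ω, max (-L ω) 0 ∂P + 2 * R m)) atTop := by
        refine liminf_le_liminf (Eventually.of_forall fun m => ?_)
        rw [← ofReal_integral_eq_lintegral_ofReal (hFi m) (ae_of_all _ fun ω => (hFb m ω).1)]
        exact ENNReal.ofReal_le_ofReal (hbound m)
    _ = ENNReal.ofReal (∫ ω, max (-L ω) 0 ∂P) := by
        refine Tendsto.liminf_eq ((ENNReal.continuous_ofReal.tendsto _).comp ?_)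
        simpa using (hR0.const_mul 2).const_add (∫ ω, max (-L ω) 0 ∂P)
    _ = _ := hneg'.symm

lemma lintegral_pos_part_eq_of_tendsto [IsProbabilityMeasure P] (hM : Martingale M 𝒢 P) {T : ι}
    {C : ℝ} (hC : 0 ≤ C) {L : Ω → ℝ} {A : ℕ → Ω → ℝ}
    (hA : ∀ n, IsDiscreteIntegral 𝒢 M T C (A n))
    (hL : ∀ᵐ ω ∂P, Tendsto (fun n => A n ω) atTop (𝓝 (L ω))) :
    ∫⁻ ω, ENNReal.ofReal (L ω) ∂P = ∫⁻ ω, ENNReal.ofReal (-L ω) ∂P := by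
  refine le_antisymm (lintegral_pos_part_le_of_tendsto hM hC hA hL) ?_
  have := lintegral_pos_part_le_of_tendsto hM hC (fun n => (hA n).neg) (L := fun ω => -L ω)
    (hL.mono fun ω h => h.neg)
  simpa only [neg_neg] using this

/-- The absolute value of a martingale is a submartingale: the sign of M s is known at time s, so
D·sign(M s)·(M t - M s) has mean zero. -/
lemma integral_mul_abs_le [IsFiniteMeasure P] (hM : Martingale M 𝒢 P) {s t : ι}
    (hst : s ≤ t) {D : Ω → ℝ} (hD : Measurable[𝒢 s] D) (hD0 : ∀ ω, 0 ≤ D ω) {c : ℝ}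
    (hc : ∀ ω, D ω ≤ c) :
    ∫ ω, D ω * |M s ω| ∂P ≤ ∫ ω, D ω * |M t ω| ∂P := by
  have hsm : Measurable[𝒢 s] (M s) := (hM.1 s).measurable
  set σ : Ω → ℝ := fun ω => if 0 ≤ M s ω then 1 else -1 with hσ
  have hσm : Measurable[𝒢 s] σ := Measurable.ite
    (hsm measurableSet_Ici) measurable_const measurable_const
  have hσ1 : ∀ ω, |σ ω| = 1 := fun ω => by simp only [hσ]; split_ifs <;> simp
  have hσs : ∀ ω, σ ω * M s ω = |M s ω| := fun ω => by
    simp only [hσ]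
    split_ifs with h
    · rw [one_mul, abs_of_nonneg h]
    · rw [abs_of_neg (not_le.1 h), neg_one_mul]
  obtain ⟨h1, h2⟩ := integral_mul_martingale_sub hM hst (K := fun ω => D ω * σ ω)
    (hD.mul hσm).stronglyMeasurable (c := c) fun ω => by
      rw [abs_mul, hσ1, mul_one, abs_of_nonneg (hD0 ω)]; exact hc ω
  have hint : ∀ u, Integrable (fun ω => D ω * |M u ω|) P := fun u =>
    (hM.integrable u).abs.bdd_mul (hD.mono (𝒢.le s) le_rfl).aestronglyMeasurable (c := c)
      (ae_of_all _ fun ω => by rw [Real.norm_eq_abs, abs_of_nonneg (hD0 ω)]; exact hc ω)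
  have h3 : ∫ ω, (D ω * |M s ω| + D ω * σ ω * (M t ω - M s ω)) ∂P ≤ ∫ ω, D ω * |M t ω| ∂P := by
    refine integral_mono ((hint s).add h1) (hint t) fun ω => ?_
    have e : D ω * |M s ω| + D ω * σ ω * (M t ω - M s ω) = D ω * (σ ω * M t ω) := by
      rw [← hσs]; ring
    simp only [e]
    refine mul_le_mul_of_nonneg_left ((le_abs_self _).trans (le_of_eq ?_)) (hD0 ω)
    rw [abs_mul, hσ1, one_mul]
  rwa [integral_add (hint s) h1, h2, add_zero] at h3

lemma sum_mul_sub_eq (H m : ℕ → ℝ) (n : ℕ) :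
    ∑ k ∈ Finset.range n, H k * (m (k + 1) - m k)
      = H n * m n - H 0 * m 0 - ∑ k ∈ Finset.range n, m (k + 1) * (H (k + 1) - H k) := by
  induction n with
  | zero => simp
  | succ n ih => rw [Finset.sum_range_succ, ih, Finset.sum_range_succ]; ring

/-- Discrete stochastic integrals of integrands of bounded variation are bounded in mean. -/
lemma integral_abs_sum_le [IsFiniteMeasure P] (hM : Martingale M 𝒢 P) {n : ℕ} {t : ℕ → ι}
    (ht : Monotone t) {H : ℕ → Ω → ℝ} (hH : ∀ k, Measurable[𝒢 (t k)] (H k))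
    (hH0 : ∀ ω, H 0 ω = 0) {V : ℝ}
    (hV : ∀ ω, ∑ k ∈ Finset.range n, |H (k + 1) ω - H k ω| ≤ V) :
    Integrable (fun ω => ∑ k ∈ Finset.range n, H k ω * (M (t (k + 1)) ω - M (t k) ω)) P ∧
    ∫ ω, |∑ k ∈ Finset.range n, H k ω * (M (t (k + 1)) ω - M (t k) ω)| ∂P
      ≤ 2 * V * ∫ ω, |M (t n) ω| ∂P := by
  have hHn : ∀ ω, |H n ω| ≤ V := fun ω => by
    have : H n ω = ∑ k ∈ Finset.range n, (H (k + 1) ω - H k ω) := by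
      rw [Finset.sum_range_sub (fun k => H k ω), hH0, sub_zero]
    rw [this]
    exact (Finset.abs_sum_le_sum_abs _ _).trans (hV ω)
  have hDm : ∀ k, Measurable[𝒢 (t (k + 1))] fun ω => |H (k + 1) ω - H k ω| := fun k =>
    measurable_abs.comp ((hH (k + 1)).sub ((hH k).mono (𝒢.mono (ht k.le_succ)) le_rfl))
  have hDV : ∀ k ∈ Finset.range n, ∀ ω, |H (k + 1) ω - H k ω| ≤ V := fun k hk ω =>
    (Finset.single_le_sum (f := fun k => |H (k + 1) ω - H k ω|) (fun i _ => abs_nonneg _)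
      hk).trans (hV ω)
  have hint : ∀ k ∈ Finset.range n, ∀ u,
      Integrable (fun ω => |H (k + 1) ω - H k ω| * |M u ω|) P := fun k hk u =>
    (hM.integrable u).abs.bdd_mul ((hDm k).mono (𝒢.le _) le_rfl).aestronglyMeasurable (c := V)
      (ae_of_all _ fun ω => by rw [Real.norm_eq_abs, abs_abs]; exact hDV k hk ω)
  -- Summation by parts shifts the differences from M to H; `integral_mul_abs_le` then moves every
  -- |M| to the final time.
  have hb : ∀ ω, |∑ k ∈ Finset.range n, H k ω * (M (t (k + 1)) ω - M (t k) ω)|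
      ≤ V * |M (t n) ω| + ∑ k ∈ Finset.range n, |H (k + 1) ω - H k ω| * |M (t (k + 1)) ω| := by
    intro ω
    rw [sum_mul_sub_eq (fun k => H k ω) (fun k => M (t k) ω) n]
    simp only [hH0, zero_mul, sub_zero]
    refine (abs_sub _ _).trans (add_le_add ?_ ?_)
    · rw [abs_mul]
      exact mul_le_mul_of_nonneg_right (hHn ω) (abs_nonneg _)
    · refine (Finset.abs_sum_le_sum_abs _ _).trans (le_of_eq (Finset.sum_congr rfl fun k _ => ?_))
      rw [abs_mul, mul_comm]
  have hrhs : Integrable (fun ω => V * |M (t n) ω|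
      + ∑ k ∈ Finset.range n, |H (k + 1) ω - H k ω| * |M (t (k + 1)) ω|) P :=
    ((hM.integrable _).abs.const_mul V).add (integrable_finsetSum _ fun k hk => hint k hk _)
  have hm : Measurable fun ω => ∑ k ∈ Finset.range n, H k ω * (M (t (k + 1)) ω - M (t k) ω) :=
    Finset.measurable_sum _ fun k _ => ((hH k).mono (𝒢.le _) le_rfl).mul
      (((hM.1 _).mono (𝒢.le _)).measurable.sub ((hM.1 _).mono (𝒢.le _)).measurable)
  have hi := Integrable.mono' hrhs hm.aestronglyMeasurable (ae_of_all _ hb)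
  refine ⟨hi, ?_⟩
  calc _ ≤ ∫ ω, (V * |M (t n) ω|
      + ∑ k ∈ Finset.range n, |H (k + 1) ω - H k ω| * |M (t (k + 1)) ω|) ∂P :=
        integral_mono hi.abs hrhs hb
    _ = V * ∫ ω, |M (t n) ω| ∂P
      + ∑ k ∈ Finset.range n, ∫ ω, |H (k + 1) ω - H k ω| * |M (t (k + 1)) ω| ∂P := by
        rw [integral_add ((hM.integrable _).abs.const_mul V)
          (integrable_finsetSum _ fun k hk => hint k hk _), integral_const_mul,
          integral_finsetSum _ fun k hk => hint k hk _]
    _ ≤ V * ∫ ω, |M (t n) ω| ∂P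
      + ∑ k ∈ Finset.range n, ∫ ω, |H (k + 1) ω - H k ω| * |M (t n) ω| ∂P :=
        add_le_add le_rfl (Finset.sum_le_sum fun k hk => integral_mul_abs_le hM
          (ht (Finset.mem_range.1 hk)) (hDm k) (fun ω => abs_nonneg _) (hDV k hk))
    _ = V * ∫ ω, |M (t n) ω| ∂P
      + ∫ ω, (∑ k ∈ Finset.range n, |H (k + 1) ω - H k ω|) * |M (t n) ω| ∂P := by
        rw [← integral_finsetSum _ fun k hk => hint k hk _]
        simp only [Finset.sum_mul]
    _ ≤ V * ∫ ω, |M (t n) ω| ∂P + V * ∫ ω, |M (t n) ω| ∂P := by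
        refine add_le_add le_rfl ?_
        rw [← integral_const_mul]
        refine integral_mono ?_ ((hM.integrable _).abs.const_mul V) fun ω =>
          mul_le_mul_of_nonneg_right (hV ω) (abs_nonneg _)
        simp only [Finset.sum_mul]
        exact integrable_finsetSum _ fun k hk => hint k hk _
    _ = _ := by ring

/-- Fatou's lemma for functions bounded in mean. -/
lemma integrable_of_tendsto_of_integral_abs_le {L : Ω → ℝ} {A : ℕ → Ω → ℝ} {K : ℝ}
    (hA : ∀ n, Integrable (A n) P) (hK : ∀ n, ∫ ω, |A n ω| ∂P ≤ K)
    (hL : ∀ᵐ ω ∂P, Tendsto (fun n => A n ω) atTop (𝓝 (L ω))) : Integrable L P := by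
  refine ⟨aestronglyMeasurable_of_tendsto_ae atTop (fun n => (hA n).aestronglyMeasurable) hL, ?_⟩
  have h1 : ∫⁻ ω, ‖L ω‖ₑ ∂P ≤ liminf (fun n => ∫⁻ ω, ‖A n ω‖ₑ ∂P) atTop := by
    calc ∫⁻ ω, ‖L ω‖ₑ ∂P = ∫⁻ ω, liminf (fun n => ‖A n ω‖ₑ) atTop ∂P :=
          lintegral_congr_ae (hL.mono fun ω h => h.enorm.liminf_eq.symm)
      _ ≤ _ := lintegral_liminf_le' fun n => (hA n).aestronglyMeasurable.enorm
  refine (h1.trans (liminf_le_of_le (a := ENNReal.ofReal K) (by isBoundedDefault)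
    fun b hb => ?_)).trans_lt ENNReal.ofReal_lt_top
  obtain ⟨n, hn⟩ := hb.exists
  refine hn.trans ?_
  rw [← ofReal_integral_norm_eq_lintegral_enorm (hA n)]
  exact ENNReal.ofReal_le_ofReal (hK n)

end Limit

/-! ### Equidistant partitions -/

section Grid

variable {T : ℝ≥0}

/-- The `k`-th point of the equidistant partition of `[0, T]` into `n + 1` intervals. -/
def gridTime (T : ℝ≥0) (n k : ℕ) : ℝ≥0 := T * k / (n + 1)

lemma gridTime_monotone (T : ℝ≥0) (n : ℕ) : Monotone (gridTime T n) := fun i j hij => by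
  unfold gridTime
  gcongr

@[simp] lemma gridTime_zero (T : ℝ≥0) (n : ℕ) : gridTime T n 0 = 0 := by simp [gridTime]

@[simp] lemma gridTime_last (T : ℝ≥0) (n : ℕ) : gridTime T n (n + 1) = T := by
  unfold gridTime
  push_cast
  field_simp

lemma gridTime_le (T : ℝ≥0) {n k : ℕ} (hk : k ≤ n + 1) : gridTime T n k ≤ T := by
  simpa using gridTime_monotone T n hk

lemma coe_gridTime_succ (T : ℝ≥0) (n k : ℕ) :
    (gridTime T n (k + 1) : ℝ) = gridTime T n k + T * (1 / ((n : ℝ) + 1)) := by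
  unfold gridTime
  push_cast
  field_simp

/-- The index of the interval of the partition that contains `s`. -/
def gridIndex (T : ℝ≥0) (n : ℕ) (s : ℝ≥0) : ℕ := ⌈s * (n + 1) / T⌉₊ - 1

lemma mem_gridInterval (hT : 0 < T) (n : ℕ) {s : ℝ≥0} (hs : 0 < s) :
    gridTime T n (gridIndex T n s) < s ∧ s ≤ gridTime T n (gridIndex T n s + 1) := by
  -- For s > 0 the ceiling is positive, so the truncated subtraction in `gridIndex` is a true one.
  have hpos : 0 < ⌈s * (n + 1) / T⌉₊ := Nat.ceil_pos.2 (by positivity)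
  have e : gridIndex T n s + 1 = ⌈s * (n + 1) / T⌉₊ := Nat.sub_add_cancel hpos
  constructor
  · have h1 : gridIndex T n s < ⌈s * (n + 1) / T⌉₊ := by omega
    have h2 := Nat.lt_ceil.1 h1
    unfold gridTime
    rw [lt_div_iff₀ hT] at h2
    rw [div_lt_iff₀ (by positivity), mul_comm T]
    exact h2
  · rw [e]
    have h2 := Nat.le_ceil (s * (n + 1) / T)
    unfold gridTime
    rw [div_le_iff₀ hT] at h2
    rw [le_div_iff₀ (by positivity), mul_comm T]
    exact h2

lemma gridIndex_unique (hT : 0 < T) {n k : ℕ} {s : ℝ≥0} (h1 : gridTime T n k < s)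
    (h2 : s ≤ gridTime T n (k + 1)) : gridIndex T n s = k := by
  obtain ⟨h3, h4⟩ := mem_gridInterval hT n (h1.trans_le' zero_le)
  refine le_antisymm ?_ ?_ <;> by_contra! hc
  · exact absurd (h2.trans (gridTime_monotone T n hc)) (not_le.2 h3)
  · exact absurd (h4.trans (gridTime_monotone T n hc)) (not_le.2 h1)

lemma gridIndex_lt (hT : 0 < T) (n : ℕ) {s : ℝ≥0} (hs : 0 < s) (hsT : s ≤ T) :
    gridIndex T n s < n + 1 := by
  by_contra! hc
  have h := gridTime_monotone T n hc
  rw [gridTime_last] at h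
  exact absurd (hsT.trans h) (not_le.2 (mem_gridInterval hT n hs).1)

lemma tendsto_mesh (T : ℝ≥0) : Tendsto (fun n : ℕ => (T : ℝ) * (1 / ((n : ℝ) + 1))) atTop (𝓝 0) := by
  simpa using tendsto_one_div_add_atTop_nhds_zero_nat.const_mul (T : ℝ)

lemma tendsto_gridTime_index (hT : 0 < T) {s : ℝ≥0} (hs : 0 < s) :
    Tendsto (fun n => gridTime T n (gridIndex T n s)) atTop (𝓝 s) := by
  rw [← NNReal.tendsto_coe]
  refine tendsto_of_tendsto_of_tendsto_of_le_of_le (g := fun n : ℕ => (s : ℝ) - T * (1 / ((n : ℝ) + 1)))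
    (by simpa using (tendsto_mesh T).const_sub (s : ℝ)) tendsto_const_nhds (fun n => ?_)
    (fun n => NNReal.coe_le_coe.2 (mem_gridInterval hT n hs).1.le)
  have h := NNReal.coe_le_coe.2 (mem_gridInterval hT n hs).2
  rw [coe_gridTime_succ] at h
  simp only
  linarith

/-- Right endpoints approach s from the side on which càdlàg paths are continuous. -/
lemma tendsto_gridTime_index_succ (hT : 0 < T) {s : ℝ≥0} (hs : 0 < s) :
    Tendsto (fun n => gridTime T n (gridIndex T n s + 1)) atTop (𝓝[≥] s) := by
  refine tendsto_nhdsWithin_iff.2 ⟨?_, Eventually.of_forall fun n => (mem_gridInterval hT n hs).2⟩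
  rw [← NNReal.tendsto_coe]
  have h := (NNReal.tendsto_coe.2 (tendsto_gridTime_index hT hs)).add (tendsto_mesh T)
  simpa only [coe_gridTime_succ, add_zero] using h

end Grid

/-! ### Riemann sums along càdlàg paths -/

section Path

variable {p : ℝ≥0 → ℝ} {T : ℝ≥0}

lemma exists_bound_of_cadlag (hp : ∀ t, ContinuousWithinAt p (Ici t) t ∧
    ∃ l : ℝ, Tendsto p (𝓝[<] t) (𝓝 l)) (T : ℝ≥0) : ∃ B, ∀ s ≤ T, |p s| ≤ B := by
  have hc : IsCompact (Icc (0 : ℝ≥0) T) := isCompact_Icc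
  obtain ⟨B, hB⟩ := hc.induction_on (p := fun S => ∃ B, ∀ s ∈ S, |p s| ≤ B) ⟨0, by simp⟩
    (fun S S' h ⟨B, hB⟩ => ⟨B, fun s hs => hB s (h hs)⟩)
    (fun S S' ⟨B, hB⟩ ⟨B', hB'⟩ => ⟨max B B', fun s hs => hs.elim
      (fun h => (hB s h).trans (le_max_left _ _)) (fun h => (hB' s h).trans (le_max_right _ _))⟩)
    (fun t _ => by
      obtain ⟨h1, l, h2⟩ := hp t
      have e1 : ∀ᶠ s in 𝓝[≥] t, |p s| < |p t| + 1 :=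
        h1.abs.eventually (gt_mem_nhds (lt_add_one _))
      have e2 : ∀ᶠ s in 𝓝[<] t, |p s| < |l| + 1 :=
        h2.abs.eventually (gt_mem_nhds (lt_add_one _))
      have e3 : ∀ᶠ s in 𝓝 t, |p s| ≤ max (|p t| + 1) (|l| + 1) := by
        rw [← nhdsLT_sup_nhdsGE]
        exact eventually_sup.2 ⟨e2.mono fun s hs => hs.le.trans (le_max_right _ _),
          e1.mono fun s hs => hs.le.trans (le_max_left _ _)⟩
      exact ⟨_, mem_nhdsWithin_of_mem_nhds e3, _, fun s hs => hs⟩)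
  exact ⟨B, fun s hs => hB s ⟨zero_le, hs⟩⟩

variable {f : ℝ → ℝ}

lemma intervalIntegrable_grid (hT : 0 < T) (hf : IntervalIntegrable f volume 0 T) (n : ℕ) {k : ℕ}
    (hk : k < n + 1) :
    IntervalIntegrable (fun s => f s * p (gridTime T n (gridIndex T n s.toNNReal + 1))) volume
      (gridTime T n k) (gridTime T n (k + 1)) ∧
    ∫ s in (gridTime T n k : ℝ)..gridTime T n (k + 1),
        f s * p (gridTime T n (gridIndex T n s.toNNReal + 1))
      = p (gridTime T n (k + 1)) *
        ((∫ s in (0 : ℝ)..gridTime T n (k + 1), f s) - ∫ s in (0 : ℝ)..gridTime T n k, f s) := by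
  have h0 : ∀ j, j ≤ n + 1 → (gridTime T n j : ℝ) ∈ Icc (0 : ℝ) T := fun j hj =>
    ⟨NNReal.coe_nonneg _, NNReal.coe_le_coe.2 (gridTime_le T hj)⟩
  have hsub : ∀ a b : ℝ, a ∈ Icc (0 : ℝ) T → b ∈ Icc (0 : ℝ) T → IntervalIntegrable f volume a b :=
    fun a b ha hb => hf.mono_set (by
      rw [uIcc_of_le (NNReal.coe_nonneg T)]
      exact uIcc_subset_Icc ha hb)
  have hle : (gridTime T n k : ℝ) ≤ gridTime T n (k + 1) :=
    NNReal.coe_le_coe.2 (gridTime_monotone T n k.le_succ)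
  have hfk := hsub _ _ (h0 k hk.le) (h0 (k + 1) hk)
  have he : EqOn (fun s => f s * p (gridTime T n (k + 1)))
      (fun s => f s * p (gridTime T n (gridIndex T n s.toNNReal + 1)))
      (uIoc (gridTime T n k : ℝ) (gridTime T n (k + 1))) := by
    rw [uIoc_of_le hle]
    intro s hs
    have : gridIndex T n s.toNNReal = k := gridIndex_unique hT
      (Real.lt_toNNReal_iff_coe_lt.2 hs.1) (Real.toNNReal_le_iff_le_coe.2 hs.2)
    simp only [this]
  refine ⟨(hfk.mul_const _).congr he, ?_⟩
  rw [← intervalIntegral.integral_congr_ae (ae_of_all _ he), intervalIntegral.integral_mul_const,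
    intervalIntegral.integral_interval_sub_left (hsub _ _ ⟨le_rfl, NNReal.coe_nonneg T⟩ (h0 _ hk))
      (hsub _ _ ⟨le_rfl, NNReal.coe_nonneg T⟩ (h0 _ hk.le)), mul_comm]

lemma sum_grid_eq_integral (hT : 0 < T) (hf : IntervalIntegrable f volume 0 T) (n : ℕ) :
    IntervalIntegrable (fun s => f s * p (gridTime T n (gridIndex T n s.toNNReal + 1))) volume
      0 T ∧
    ∑ k ∈ Finset.range (n + 1), p (gridTime T n (k + 1)) *
        ((∫ s in (0 : ℝ)..gridTime T n (k + 1), f s) - ∫ s in (0 : ℝ)..gridTime T n k, f s)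
      = ∫ s in (0 : ℝ)..T, f s * p (gridTime T n (gridIndex T n s.toNNReal + 1)) := by
  have h1 := fun k hk => (intervalIntegrable_grid (p := p) hT hf n (k := k) hk).1
  have h2 := intervalIntegral.sum_integral_adjacent_intervals
    (a := fun k => (gridTime T n k : ℝ)) h1
  have h3 := IntervalIntegrable.trans_iterate (a := fun k => (gridTime T n k : ℝ)) h1
  simp only [gridTime_zero, gridTime_last, NNReal.coe_zero] at h2 h3
  refine ⟨h3, h2 ▸ Finset.sum_congr rfl fun k hk => ?_⟩
  exact (intervalIntegrable_grid hT hf n (Finset.mem_range.1 hk)).2.symm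

lemma tendsto_mul_grid (hp : ∀ t, ContinuousWithinAt p (Ici t) t) (hT : 0 < T) {s : ℝ}
    (hs : 0 < s) :
    Tendsto (fun n => f s * p (gridTime T n (gridIndex T n s.toNNReal + 1))) atTop
      (𝓝 (f s * p s.toNNReal)) :=
  ((hp _).tendsto.comp (tendsto_gridTime_index_succ hT (Real.toNNReal_pos.2 hs))).const_mul _

/-- Measurability comes from approximating the path by its values at right endpoints; integrability
from its boundedness on compact intervals. -/
lemma intervalIntegrable_mul_cadlag (hp : ∀ t, ContinuousWithinAt p (Ici t) t ∧
    ∃ l : ℝ, Tendsto p (𝓝[<] t) (𝓝 l)) (hT : 0 < T) (hf : IntervalIntegrable f volume 0 T) :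
    IntervalIntegrable (fun s => f s * p s.toNNReal) volume 0 T := by
  obtain ⟨B, hB⟩ := exists_bound_of_cadlag hp T
  have hm : AEStronglyMeasurable (fun s => f s * p s.toNNReal)
      (volume.restrict (uIoc (0 : ℝ) T)) := by
    refine aestronglyMeasurable_of_tendsto_ae atTop (f := fun n s =>
      f s * p (gridTime T n (gridIndex T n s.toNNReal + 1))) (fun n => ?_) ?_
    · rw [uIoc_of_le (NNReal.coe_nonneg T)]
      exact (sum_grid_eq_integral hT hf n).1.1.aestronglyMeasurable
    · refine (ae_restrict_iff' measurableSet_uIoc).2 (ae_of_all _ fun s hs => ?_)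
      rw [uIoc_of_le (NNReal.coe_nonneg T)] at hs
      exact tendsto_mul_grid (fun t => (hp t).1) hT hs.1
  refine (hf.norm.mul_const B).mono_fun' hm ?_
  refine (ae_restrict_iff' measurableSet_uIoc).2 (ae_of_all _ fun s hs => ?_)
  rw [uIoc_of_le (NNReal.coe_nonneg T)] at hs
  simp only [norm_mul, Real.norm_eq_abs (p _)]
  exact mul_le_mul_of_nonneg_left (hB _ (Real.toNNReal_le_iff_le_coe.2 hs.2)) (norm_nonneg _)

lemma tendsto_sum_grid (hp : ∀ t, ContinuousWithinAt p (Ici t) t ∧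
    ∃ l : ℝ, Tendsto p (𝓝[<] t) (𝓝 l)) (hT : 0 < T) (hf : IntervalIntegrable f volume 0 T) :
    Tendsto (fun n => ∑ k ∈ Finset.range (n + 1), p (gridTime T n (k + 1)) *
        ((∫ s in (0 : ℝ)..gridTime T n (k + 1), f s) - ∫ s in (0 : ℝ)..gridTime T n k, f s))
      atTop (𝓝 (∫ s in (0 : ℝ)..T, f s * p s.toNNReal)) := by
  obtain ⟨B, hB⟩ := exists_bound_of_cadlag hp T
  simp only [fun n => (sum_grid_eq_integral (p := p) hT hf n).2]
  refine intervalIntegral.tendsto_integral_filter_of_dominated_convergence (fun s => ‖f s‖ * B)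
    (Eventually.of_forall fun n => ?_) (Eventually.of_forall fun n => ae_of_all _ fun s hs => ?_)
    (hf.norm.mul_const B) (ae_of_all _ fun s hs => ?_)
  · rw [uIoc_of_le (NNReal.coe_nonneg T)]
    exact (sum_grid_eq_integral hT hf n).1.1.aestronglyMeasurable
  · rw [uIoc_of_le (NNReal.coe_nonneg T)] at hs
    rw [norm_mul, Real.norm_eq_abs (p _)]
    refine mul_le_mul_of_nonneg_left (hB _ (gridTime_le T ?_)) (norm_nonneg _)
    exact gridIndex_lt hT n (Real.toNNReal_pos.2 hs.1) (Real.toNNReal_le_iff_le_coe.2 hs.2)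
  · rw [uIoc_of_le (NNReal.coe_nonneg T)] at hs
    exact tendsto_mul_grid (fun t => (hp t).1) hT hs.1

/-- Only the interval (t_k, t_{k+1}] containing τ contributes. If τ ≤ ρ, then t_k < ρ always; if ρ <
τ, then t_k → τ exceeds ρ eventually, and late cancellation on the grid does no harm. -/
lemma tendsto_sum_grid_jump (hp : ∀ t, ContinuousWithinAt p (Ici t) t) (hT : 0 < T)
    {τ : ℝ≥0} (hτ : 0 < τ) (hτT : τ ≤ T) (ρ : ℝ≥0) :
    Tendsto (fun n => ∑ k ∈ Finset.range (n + 1), p (gridTime T n (k + 1)) *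
        (if gridTime T n k < ρ then (if τ ≤ gridTime T n (k + 1) then (1 : ℝ) else 0)
          - (if τ ≤ gridTime T n k then 1 else 0) else 0))
      atTop (𝓝 (if τ ≤ ρ then p τ else 0)) := by
  have hsum : ∀ n, ∑ k ∈ Finset.range (n + 1), p (gridTime T n (k + 1)) *
        (if gridTime T n k < ρ then (if τ ≤ gridTime T n (k + 1) then (1 : ℝ) else 0)
          - (if τ ≤ gridTime T n k then 1 else 0) else 0)
      = if gridTime T n (gridIndex T n τ) < ρ then p (gridTime T n (gridIndex T n τ + 1)) else 0 := by
    intro n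
    obtain ⟨h1, h2⟩ := mem_gridInterval hT n hτ
    rw [Finset.sum_eq_single (gridIndex T n τ)]
    · rw [if_pos h2, if_neg (not_le.2 h1)]
      split_ifs <;> simp
    · intro k _ hk
      have : (τ ≤ gridTime T n (k + 1)) ↔ (τ ≤ gridTime T n k) := by
        refine ⟨fun h => ?_, fun h => h.trans (gridTime_monotone T n k.le_succ)⟩
        by_contra! hc
        exact hk (gridIndex_unique hT hc h).symm
      simp [this]
    · intro h
      exact absurd (Finset.mem_range.2 (gridIndex_lt hT n hτ hτT)) h
  simp only [hsum]
  have hlim := (hp τ).tendsto.comp (tendsto_gridTime_index_succ hT hτ)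
  split_ifs with h
  · refine hlim.congr fun n => ?_
    rw [if_pos ((mem_gridInterval hT n hτ).1.trans_le h)]
    rfl
  · refine tendsto_const_nhds.congr' ?_
    filter_upwards [(tendsto_gridTime_index hT hτ).eventually (lt_mem_nhds (not_le.1 h))] with n hn
    rw [if_neg (not_lt.2 hn.le)]

end Path

/-! ### Executions in the dark pool -/

namespace Model

variable {Ω : Type*} [MeasurableSpace Ω] {P : Measure Ω} (M : Model P)

section Orders

variable (Xhat Xi : ℝ)

lemma filled_le (n : ℕ) (ω : Ω) : M.filled Xhat Xi n ω ≤ |Xhat| := by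
  induction n with
  | zero => exact abs_nonneg _
  | succ n ih =>
    simp only [filled]
    split_ifs
    · have : (min (M.Ytil n ω) (ENNReal.ofReal (|Xhat| - M.filled Xhat Xi n ω))).toReal
          ≤ |Xhat| - M.filled Xhat Xi n ω :=
        (ENNReal.toReal_mono ENNReal.ofReal_ne_top (min_le_right _ _)).trans
          (ENNReal.toReal_ofReal (by linarith)).le
      linarith
    · linarith

lemma filled_monotone (ω : Ω) : Monotone fun n => M.filled Xhat Xi n ω := by
  refine monotone_nat_of_le_succ fun n => ?_
  simp only [filled]
  split_ifs
  · exact le_add_of_nonneg_right ENNReal.toReal_nonneg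
  · simp

lemma filled_nonneg (n : ℕ) (ω : Ω) : 0 ≤ M.filled Xhat Xi n ω :=
  M.filled_monotone Xhat Xi ω (Nat.zero_le n)

lemma sum_Y (n : ℕ) (ω : Ω) :
    ∑ i ∈ Finset.range n, M.Y Xhat Xi i ω = Real.sign Xhat * M.filled Xhat Xi n ω := by
  simp only [Y, ← Finset.mul_sum]
  rw [Finset.sum_range_sub (fun i => M.filled Xhat Xi i ω)]
  simp [filled]

lemma Z_eq (t : ℝ≥0) (ω : Ω) :
    M.Z Xhat Xi t ω = Real.sign Xhat * M.filled Xhat Xi (M.N t ω) ω :=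
  M.sum_Y Xhat Xi _ ω

lemma N_mono (ω : Ω) : Monotone fun t => M.N t ω := by
  intro s t hst
  by_contra! hc
  have h1 := (M.lt_N_iff s ω (M.N t ω)).1 hc
  exact absurd ((M.lt_N_iff t ω (M.N t ω)).2 (h1.trans hst)) (lt_irrefl _)

lemma τ_pos' (i : ℕ) (ω : Ω) : 0 < M.τ i ω :=
  (M.τ_pos ω).trans_le ((M.τ_strictMono ω).monotone (Nat.zero_le i))

lemma sum_range_N {s t : ℝ≥0} (hst : s ≤ t) (ω : Ω) (g : ℕ → ℝ) :
    ∑ i ∈ Finset.range (M.N s ω), g i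
      = ∑ i ∈ Finset.range (M.N t ω), if M.τ i ω ≤ s then g i else 0 := by
  rw [← Finset.sum_filter]
  refine Finset.sum_congr ?_ fun _ _ => rfl
  ext i
  simp only [Finset.mem_range, Finset.mem_filter, M.lt_N_iff]
  exact ⟨fun h => ⟨h.trans hst, h⟩, fun h => h.2⟩

lemma Z_eq_sum {s t : ℝ≥0} (hst : s ≤ t) (ω : Ω) :
    M.Z Xhat Xi s ω = ∑ i ∈ Finset.range (M.N t ω),
      M.Y Xhat Xi i ω * if M.τ i ω ≤ s then 1 else 0 := by
  rw [Z, M.sum_range_N hst]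
  simp

lemma measurable_Z_𝒢 (t : ℝ≥0) : Measurable[M.𝒢 Xhat Xi t] (M.Z Xhat Xi t) := by
  rw [measurable_iff_comap_le]
  refine le_trans ?_ ((M.rawFiltration Xhat Xi).le_rightCont t)
  refine le_trans ?_ (le_sup_right (a := M.ℱ t))
  exact le_iSup_of_le (⟨t, mem_Iic.2 le_rfl⟩ : Iic t) le_sup_left

end Orders

/-! ### The position as integrand, and the unaffected costs -/

section Position

variable (χ : Strategy Ω)

/-- The number of shares bought in the dark pool until the `k`-th point of the partition, if the
order is cancelled at the first point of the partition that is not before `ρ`. -/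
def gridDark (T : ℝ≥0) (n k : ℕ) (ω : Ω) : ℝ :=
  ∑ j ∈ Finset.range k, if gridTime T n j < χ.ρ ω then
    M.Z χ.Xhat χ.Xi (gridTime T n (j + 1)) ω - M.Z χ.Xhat χ.Xi (gridTime T n j) ω else 0

/-- The total position at the `k`-th point of the partition; the part held at the exchange is
truncated at the level `C`. -/
def gridPosition (T : ℝ≥0) (C : ℝ) (n k : ℕ) (ω : Ω) : ℝ :=
  max (-C) (min C (χ.exchange (gridTime T n k) ω)) + M.gridDark χ T n k ω

/-- The costs of a round trip without any price impact. -/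
def unaffectedCost (T : ℝ) (ω : Ω) : ℝ :=
  (∫ t in (0 : ℝ)..T, χ.ξ t.toNNReal ω * M.P0 t.toNNReal ω)
    + ∑ i ∈ Finset.range (M.N (χ.ρ ω) ω), M.Y χ.Xhat χ.Xi i ω * M.P0 (M.τ i ω) ω

/-- All executions have the sign of the order, so their variation is controlled by the unsigned
filled amount, which never exceeds |Xhat|. -/
lemma abs_gridDark_succ_sub (T : ℝ≥0) (n k : ℕ) (ω : Ω) :
    |M.gridDark χ T n (k + 1) ω - M.gridDark χ T n k ω|
      ≤ M.filled χ.Xhat χ.Xi (M.N (gridTime T n (k + 1)) ω) ω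
        - M.filled χ.Xhat χ.Xi (M.N (gridTime T n k) ω) ω := by
  have hmono : 0 ≤ M.filled χ.Xhat χ.Xi (M.N (gridTime T n (k + 1)) ω) ω
        - M.filled χ.Xhat χ.Xi (M.N (gridTime T n k) ω) ω :=
    sub_nonneg.2 (M.filled_monotone _ _ ω (M.N_mono ω (gridTime_monotone T n k.le_succ)))
  rw [gridDark, gridDark, Finset.sum_range_succ, add_sub_cancel_left]
  split_ifs
  · rw [Z_eq, Z_eq, ← mul_sub, abs_mul, abs_of_nonneg hmono]
    refine mul_le_of_le_one_left hmono ?_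
    rcases Real.sign_apply_eq χ.Xhat with h | h | h <;> simp [h]
  · simpa using hmono

lemma sum_abs_gridDark_le (T : ℝ≥0) (n k : ℕ) (ω : Ω) :
    ∑ j ∈ Finset.range k, |M.gridDark χ T n (j + 1) ω - M.gridDark χ T n j ω| ≤ |χ.Xhat| := by
  refine (Finset.sum_le_sum fun j _ => M.abs_gridDark_succ_sub χ T n j ω).trans ?_
  rw [Finset.sum_range_sub fun j => M.filled χ.Xhat χ.Xi (M.N (gridTime T n j) ω) ω]
  linarith [M.filled_le χ.Xhat χ.Xi (M.N (gridTime T n k) ω) ω,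
    M.filled_nonneg χ.Xhat χ.Xi (M.N (gridTime T n 0) ω) ω]

/-- The truncation makes the bound hold for every ω, although admissibility bounds the exchange part
only almost surely. -/
lemma abs_gridPosition_le (T : ℝ≥0) {C : ℝ} (hC : 0 ≤ C) (n k : ℕ) (ω : Ω) :
    |M.gridPosition χ T C n k ω| ≤ C + |χ.Xhat| := by
  refine (abs_add_le _ _).trans (add_le_add ?_ ?_)
  · exact abs_le.2 ⟨le_max_left _ _, max_le (by linarith) (min_le_left _ _)⟩
  · have h1 : M.gridDark χ T n k ω
        = ∑ j ∈ Finset.range k, (M.gridDark χ T n (j + 1) ω - M.gridDark χ T n j ω) := by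
      rw [Finset.sum_range_sub fun j => M.gridDark χ T n j ω]
      simp [gridDark]
    rw [h1]
    exact (Finset.abs_sum_le_sum_abs _ _).trans (M.sum_abs_gridDark_le χ T n k ω)

lemma measurable_exchange {𝒢 : Filtration ℝ≥0 (inferInstance : MeasurableSpace Ω)}
    (hξ : IsStronglyPredictable 𝒢 χ.ξ) (t : ℝ≥0) :
    Measurable[𝒢 t] fun ω => χ.exchange t ω := by
  let m : MeasurableSpace Ω := 𝒢 t
  have h1 : StronglyMeasurable fun p : Iic t × Ω => χ.ξ p.1 p.2 := hξ.isStronglyProgressive t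
  -- Capping time at t keeps the argument in `Iic t`, where progressive measurability applies,
  -- without changing the integral over (0, t].
  have h2 : Measurable fun q : ℝ × Ω =>
      ((⟨min q.1.toNNReal t, mem_Iic.2 (min_le_right _ _)⟩ : Iic t), q.2) :=
    (Measurable.subtype_mk (by fun_prop)).prodMk measurable_snd
  have h3 := h1.comp_measurable h2
  have h4 : (fun ω => χ.exchange t ω)
      = fun ω => ∫ s in Ioc (0 : ℝ) t, χ.ξ (min s.toNNReal t) ω := by
    funext ω
    rw [Strategy.exchange, intervalIntegral.integral_of_le (NNReal.coe_nonneg t)]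
    refine setIntegral_congr_fun measurableSet_Ioc fun s hs => ?_
    rw [min_eq_left (Real.toNNReal_le_iff_le_coe.2 hs.2)]
  rw [h4]
  have h5 := h3.integral_prod_left' (μ := volume.restrict (Ioc (0 : ℝ) t))
  exact h5.measurable

lemma measurable_gridPosition {𝒢 : Filtration ℝ≥0 (inferInstance : MeasurableSpace Ω)}
    (h𝒢 : 𝒢 = M.𝒢 χ.Xhat χ.Xi) (hξ : IsStronglyPredictable 𝒢 χ.ξ)
    (hρ : IsStoppingTime 𝒢 fun ω => (χ.ρ ω : WithTop ℝ≥0)) (T : ℝ≥0) (C : ℝ) (n k : ℕ) :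
    Measurable[𝒢 (gridTime T n k)] (M.gridPosition χ T C n k) := by
  refine Measurable.add (measurable_const.max (measurable_const.min
    (measurable_exchange χ hξ _))) (Finset.measurable_sum _ fun j hj => ?_)
  have hjk : j + 1 ≤ k := Finset.mem_range.1 hj
  have hZ : ∀ i ≤ k, Measurable[𝒢 (gridTime T n k)] (M.Z χ.Xhat χ.Xi (gridTime T n i)) := by
    intro i hi
    have := M.measurable_Z_𝒢 χ.Xhat χ.Xi (gridTime T n i)
    rw [← h𝒢] at this
    exact this.mono (𝒢.mono (gridTime_monotone T n hi)) le_rfl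
  refine Measurable.ite ?_ ((hZ _ hjk).sub (hZ _ (by omega))) measurable_const
  -- Whether the order is still alive at a grid point is known there, as ρ is a stopping time.
  have h1 := (hρ (gridTime T n j)).compl
  have h2 : {ω | gridTime T n j < χ.ρ ω}
      = {ω | (χ.ρ ω : WithTop ℝ≥0) ≤ gridTime T n j}ᶜ := by
    ext ω
    simp only [mem_ofPred_eq, mem_compl_iff, WithTop.coe_le_coe, not_le]
  rw [h2]
  exact 𝒢.mono (gridTime_monotone T n (by omega)) _ h1

/-- The discrete stochastic integral of the position with respect to the unaffected price. -/
def gridIntegral (T : ℝ≥0) (C : ℝ) (n : ℕ) (ω : Ω) : ℝ :=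
  ∑ k ∈ Finset.range (n + 1), M.gridPosition χ T C n k ω *
    (M.P0 (gridTime T n (k + 1)) ω - M.P0 (gridTime T n k) ω)

lemma tendsto_sum_gridDark {T : ℝ≥0} (hT : 0 < T) {ω : Ω} (hρ : χ.ρ ω ≤ T) {p : ℝ≥0 → ℝ}
    (hp : ∀ t, ContinuousWithinAt p (Ici t) t) :
    Tendsto (fun n => ∑ k ∈ Finset.range (n + 1), p (gridTime T n (k + 1)) *
        (M.gridDark χ T n (k + 1) ω - M.gridDark χ T n k ω)) atTop
      (𝓝 (∑ i ∈ Finset.range (M.N (χ.ρ ω) ω), M.Y χ.Xhat χ.Xi i ω * p (M.τ i ω))) := by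
  have hlim := tendsto_finsetSum (Finset.range (M.N T ω)) fun i hi =>
    (tendsto_sum_grid_jump hp hT (M.τ_pos' i ω)
      ((M.lt_N_iff T ω i).1 (Finset.mem_range.1 hi)) (χ.ρ ω)).const_mul (M.Y χ.Xhat χ.Xi i ω)
  have e : ∑ i ∈ Finset.range (M.N (χ.ρ ω) ω), M.Y χ.Xhat χ.Xi i ω * p (M.τ i ω)
      = ∑ i ∈ Finset.range (M.N T ω), M.Y χ.Xhat χ.Xi i ω *
        if M.τ i ω ≤ χ.ρ ω then p (M.τ i ω) else 0 := by
    rw [M.sum_range_N hρ]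
    simp only [mul_ite, mul_zero]
  rw [e]
  refine hlim.congr fun n => ?_
  simp only [Finset.mul_sum]
  rw [Finset.sum_comm]
  refine Finset.sum_congr rfl fun k hk => ?_
  have hk' : k < n + 1 := Finset.mem_range.1 hk
  have h1 : M.gridDark χ T n (k + 1) ω - M.gridDark χ T n k ω
      = if gridTime T n k < χ.ρ ω then
    M.Z χ.Xhat χ.Xi (gridTime T n (k + 1)) ω - M.Z χ.Xhat χ.Xi (gridTime T n k) ω else 0 := by
    rw [gridDark, gridDark, Finset.sum_range_succ, add_sub_cancel_left]
  rw [h1]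
  split_ifs
  · rw [M.Z_eq_sum χ.Xhat χ.Xi (gridTime_le T hk') ω, M.Z_eq_sum χ.Xhat χ.Xi (gridTime_le T hk'.le) ω,
      ← Finset.sum_sub_distrib, Finset.mul_sum]
    exact Finset.sum_congr rfl fun i _ => by ring
  · simp

/-- Summation by parts turns the integral of the position against the price into minus the price
paid for each trade. The boundary term at T vanishes in the limit by liquidation. -/
lemma tendsto_gridIntegral {T : ℝ≥0} (hT : 0 < T) {C : ℝ} {ω : Ω} (hρ : χ.ρ ω ≤ T)
    (hξ : IntervalIntegrable (fun t : ℝ => χ.ξ t.toNNReal ω) volume 0 T)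
    (hC : ∀ t ∈ Icc (0 : ℝ) T, |χ.exchange t ω| ≤ C)
    (hliq : χ.exchange T ω + M.Z χ.Xhat χ.Xi (χ.ρ ω) ω = 0) :
    Tendsto (fun n => M.gridIntegral χ T C n ω) atTop (𝓝 (-M.unaffectedCost χ T ω)) := by
  have hpos : ∀ n k, k ≤ n + 1 →
      M.gridPosition χ T C n k ω = χ.exchange (gridTime T n k) ω + M.gridDark χ T n k ω := by
    intro n k hk
    obtain ⟨h1, h2⟩ := abs_le.1 (hC (gridTime T n k)
      ⟨NNReal.coe_nonneg _, NNReal.coe_le_coe.2 (gridTime_le T hk)⟩)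
    rw [gridPosition, min_eq_right h2, max_eq_right h1]
  have hI : ∀ n, M.gridIntegral χ T C n ω
      = (χ.exchange T ω + M.gridDark χ T n (n + 1) ω) * M.P0 T ω
        - (∑ k ∈ Finset.range (n + 1), M.P0 (gridTime T n (k + 1)) ω *
            (χ.exchange (gridTime T n (k + 1)) ω - χ.exchange (gridTime T n k) ω)
          + ∑ k ∈ Finset.range (n + 1), M.P0 (gridTime T n (k + 1)) ω *
            (M.gridDark χ T n (k + 1) ω - M.gridDark χ T n k ω)) := by
    intro n
    rw [gridIntegral, sum_mul_sub_eq (fun k => M.gridPosition χ T C n k ω)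
      (fun k => M.P0 (gridTime T n k) ω), hpos n (n + 1) le_rfl, hpos n 0 (Nat.zero_le _),
      ← Finset.sum_add_distrib]
    have h0 : χ.exchange (gridTime T n 0) ω + M.gridDark χ T n 0 ω = 0 := by
      simp [gridDark, Strategy.exchange]
    simp only [h0, gridTime_last, zero_mul, sub_zero]
    congr 1
    refine Finset.sum_congr rfl fun k hk => ?_
    have hk' : k < n + 1 := Finset.mem_range.1 hk
    rw [hpos n (k + 1) hk', hpos n k hk'.le]
    ring
  have h1 := tendsto_sum_grid (M.P0_cadlag ω) hT hξ
  have h2 := M.tendsto_sum_gridDark χ hT hρ (p := fun t => M.P0 t ω) fun t => (M.P0_cadlag ω t).1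
  have h3 : Tendsto (fun n => M.gridDark χ T n (n + 1) ω) atTop
      (𝓝 (M.Z χ.Xhat χ.Xi (χ.ρ ω) ω)) := by
    -- The constant price 1 recovers the limit of the dark-pool position itself.
    have h := M.tendsto_sum_gridDark χ hT hρ (p := fun _ => 1) fun t => continuousWithinAt_const
    simp only [one_mul, mul_one] at h
    refine h.congr fun n => ?_
    rw [Finset.sum_range_sub fun k => M.gridDark χ T n k ω]
    simp [gridDark]
  have h4 := ((h3.const_add (χ.exchange T ω)).mul_const (M.P0 T ω)).sub (h1.add h2)
  rw [hliq, zero_mul, zero_sub] at h4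
  exact h4.congr fun n => (hI n).symm

variable {χ}

lemma IsAdmissible.ae_tendsto_gridIntegral {T : ℝ≥0} (hT : 0 < T) (hχ : M.IsAdmissible 0 T χ) :
    ∃ C, 0 ≤ C ∧ ∀ᵐ ω ∂P, Tendsto (fun n => M.gridIntegral χ T C n ω) atTop
      (𝓝 (-M.unaffectedCost χ T ω)) := by
  obtain ⟨C, hC⟩ := hχ.exchange_bounded
  refine ⟨max C 0, le_max_right _ _, ?_⟩
  filter_upwards [hC, hχ.ρ_lt, hχ.ξ_integrable, hχ.liquidation] with ω h1 h2 h3 h4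
  refine M.tendsto_gridIntegral χ hT (NNReal.coe_le_coe.1 h2.le) h3
    (fun t ht => (h1 t ht).trans (le_max_left _ _)) ?_
  simpa using h4

lemma IsAdmissible.isDiscreteIntegral {T : ℝ≥0} (hχ : M.IsAdmissible 0 T χ) {C : ℝ} (hC : 0 ≤ C)
    (n : ℕ) : IsDiscreteIntegral (M.𝒢 χ.Xhat χ.Xi) M.P0 T (C + |χ.Xhat|)
      (M.gridIntegral χ T C n) := by
  refine ⟨n + 1, gridTime T n, M.gridPosition χ T C n, gridTime_monotone T n, gridTime_last T n,
    fun k => ?_, fun k ω => M.abs_gridPosition_le χ T hC n k ω, fun ω => rfl⟩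
  exact (M.measurable_gridPosition χ rfl hχ.ξ_predictable hχ.ρ_stopping T C n k).stronglyMeasurable

/-- In the absence of price impact, the mean of the costs of a round trip vanishes if it exists. -/
lemma IsAdmissible.lintegral_unaffectedCost [IsProbabilityMeasure P] (hP0 : M.P0MartingaleEnlarged)
    {T : ℝ≥0} (hT : 0 < T) (hχ : M.IsAdmissible 0 T χ) :
    ∫⁻ ω, ENNReal.ofReal (M.unaffectedCost χ T ω) ∂P
      = ∫⁻ ω, ENNReal.ofReal (-M.unaffectedCost χ T ω) ∂P := by
  obtain ⟨C, hC, hlim⟩ := IsAdmissible.ae_tendsto_gridIntegral M hT hχ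
  have h := lintegral_pos_part_eq_of_tendsto (hP0 χ.Xhat χ.Xi hχ.Xi_nonneg hχ.Xi_le)
    (add_nonneg hC (abs_nonneg _)) (fun n => IsAdmissible.isDiscreteIntegral M hχ hC n) hlim
  simp only [neg_neg] at h
  exact h.symm

end Position

end Model

/-! ### Integral identities and Cauchy–Schwarz -/

section Primitive

variable {f : ℝ → ℝ} {a b : ℝ}

/-- Integration by parts for the absolutely continuous primitive, whose derivative is f almost
everywhere. -/
lemma integral_mul_primitive (hf : IntervalIntegrable f volume 0 b) :
    ∫ t in (0 : ℝ)..b, f t * (∫ s in (0 : ℝ)..t, f s) = (∫ s in (0 : ℝ)..b, f s) ^ 2 / 2 := by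
  have hac := hf.absolutelyContinuousOnInterval_intervalIntegral (c := 0) (by simp)
  have h1 := hac.integral_deriv_mul_eq_sub hac
  have h2 : ∫ x in (0 : ℝ)..b, deriv (fun x => ∫ s in (0 : ℝ)..x, f s) x * (∫ s in (0 : ℝ)..x, f s)
        + (∫ s in (0 : ℝ)..x, f s) * deriv (fun x => ∫ s in (0 : ℝ)..x, f s) x
      = ∫ t in (0 : ℝ)..b, 2 * (f t * (∫ s in (0 : ℝ)..t, f s)) := by
    refine intervalIntegral.integral_congr_ae ?_
    filter_upwards [hf.ae_hasDerivAt_integral] with x hx hxb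
    rw [(hx (uIoc_subset_uIcc hxb) 0 (by simp)).deriv]
    ring
  rw [h2, intervalIntegral.integral_const_mul] at h1
  simp only [intervalIntegral.integral_same] at h1
  linarith

lemma sq_integral_le (hab : a ≤ b) (hf : IntervalIntegrable f volume a b)
    (hf2 : IntervalIntegrable (fun t => f t ^ 2) volume a b) :
    (∫ t in a..b, f t) ^ 2 ≤ (b - a) * ∫ t in a..b, f t ^ 2 := by
  rcases hab.eq_or_lt with rfl | hlt
  · simp
  set I := ∫ t in a..b, f t with hI
  set m := I / (b - a) with hm
  have hba : 0 < b - a := sub_pos.2 hlt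
  have h1 : 0 ≤ ∫ t in a..b, (f t - m) ^ 2 :=
    intervalIntegral.integral_nonneg hab fun t _ => sq_nonneg _
  have h2 : ∫ t in a..b, (f t - m) ^ 2 = (∫ t in a..b, f t ^ 2) - 2 * m * I + (b - a) * m ^ 2 := by
    have e : ∀ t, (f t - m) ^ 2 = f t ^ 2 - 2 * m * f t + m ^ 2 := fun t => by ring
    simp only [e]
    rw [intervalIntegral.integral_add (hf2.sub (hf.const_mul _)) intervalIntegrable_const,
      intervalIntegral.integral_sub hf2 (hf.const_mul _), intervalIntegral.integral_const_mul,
      intervalIntegral.integral_const, smul_eq_mul]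
  have h3 : I = m * (b - a) := by rw [hm]; field_simp
  rw [h2] at h1
  have h4 := mul_nonneg hba.le h1
  nlinarith

end Primitive

lemma sum_mul_sum_range (Y : ℕ → ℝ) (n : ℕ) :
    ∑ i ∈ Finset.range n, Y i * ∑ j ∈ Finset.range i, Y j
      = ((∑ i ∈ Finset.range n, Y i) ^ 2 - ∑ i ∈ Finset.range n, Y i ^ 2) / 2 := by
  induction n with
  | zero => simp
  | succ n ih => simp only [Finset.sum_range_succ, ih]; ring

lemma Strategy.intervalIntegrable_mul_exchange {Ω : Type*} {χ : Strategy Ω} {T : ℝ≥0} {ω : Ω}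
    (hξ : IntervalIntegrable (fun t : ℝ => χ.ξ t.toNNReal ω) volume 0 T) :
    IntervalIntegrable (fun t : ℝ => χ.ξ t.toNNReal ω * χ.exchange t ω) volume 0 T := by
  refine hξ.mul_continuousOn ?_
  have h := (hξ.absolutelyContinuousOnInterval_intervalIntegral (c := 0) (by simp)).continuousOn
  exact h

/-! ### Cost decomposition and absence of manipulation -/

namespace Model

variable {Ω : Type*} [MeasurableSpace Ω] {P : Measure Ω} (M : Model P) (χ : Strategy Ω)

/-- The costs caused by the price impact, for linear impact of slope `η` and `κ = 0`, `β = 0`. -/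
def impactCost (η T : ℝ) (ω : Ω) : ℝ :=
  η * (∫ t in (0 : ℝ)..T, χ.ξ t.toNNReal ω ^ 2)
    + (1 - M.α) * (M.γ / 2 * M.Z χ.Xhat χ.Xi (χ.ρ ω) ω ^ 2
        + M.γ * ∑ i ∈ Finset.range (M.N (χ.ρ ω) ω),
          M.Y χ.Xhat χ.Xi i ω * χ.exchange (M.τ i ω) ω)
    - M.α * (M.γ / 2 * ∑ i ∈ Finset.range (M.N (χ.ρ ω) ω), M.Y χ.Xhat χ.Xi i ω ^ 2)

variable {χ} {η : ℝ} {T : ℝ≥0} {ω : Ω}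

lemma mul_exchangePrice_eq (hh : M.h = fun x => η * x) (t : ℝ) :
    χ.ξ t.toNNReal ω * M.exchangePrice χ t ω
      = χ.ξ t.toNNReal ω * M.P0 t.toNNReal ω + M.γ * (χ.ξ t.toNNReal ω * χ.exchange t ω)
        + η * χ.ξ t.toNNReal ω ^ 2 := by
  rw [exchangePrice, hh]; ring

/-- All terms of ξP other than ηξ² are integrable along paths with ξ integrable, so finiteness of
the costs is a condition on ξ² alone. -/
lemma intervalIntegrable_sq_iff (hh : M.h = fun x => η * x) (hη : η ≠ 0) (hT : 0 < T)
    (hξ : IntervalIntegrable (fun t : ℝ => χ.ξ t.toNNReal ω) volume 0 T) :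
    IntervalIntegrable (fun t : ℝ => χ.ξ t.toNNReal ω * M.exchangePrice χ t ω) volume 0 T ↔
      IntervalIntegrable (fun t : ℝ => χ.ξ t.toNNReal ω ^ 2) volume 0 T := by
  have h0 := (intervalIntegrable_mul_cadlag (M.P0_cadlag ω) hT hξ).add
    ((Strategy.intervalIntegrable_mul_exchange hξ).const_mul M.γ)
  simp only [M.mul_exchangePrice_eq hh]
  refine ⟨fun h => ?_, fun h => h0.add (h.const_mul η)⟩
  refine ((h.sub h0).const_mul η⁻¹).congr fun t _ => ?_
  field_simp
  ring

/-- Each execution with τ_i ≤ ρ contributes from τ_i on, so it is weighted by the exchange trades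
made during [τ_i, T]. -/
lemma integral_Z_mul (hρ : χ.ρ ω ≤ T)
    (hξ : IntervalIntegrable (fun t : ℝ => χ.ξ t.toNNReal ω) volume 0 T) :
    ∫ t in (0 : ℝ)..T, M.Z χ.Xhat χ.Xi (min (χ.ρ ω) t.toNNReal) ω * χ.ξ t.toNNReal ω
      = ∑ i ∈ Finset.range (M.N (χ.ρ ω) ω), M.Y χ.Xhat χ.Xi i ω *
          (χ.exchange T ω - χ.exchange (M.τ i ω) ω) := by
  have hterm : ∀ i ∈ Finset.range (M.N (χ.ρ ω) ω),
      IntervalIntegrable (fun t : ℝ => M.Y χ.Xhat χ.Xi i ω *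
        ((Ici (M.τ i ω : ℝ)).indicator (fun t : ℝ => χ.ξ t.toNNReal ω) t)) volume 0 T ∧
      ∫ t in (0 : ℝ)..T, M.Y χ.Xhat χ.Xi i ω *
        ((Ici (M.τ i ω : ℝ)).indicator (fun t : ℝ => χ.ξ t.toNNReal ω) t)
      = M.Y χ.Xhat χ.Xi i ω * (χ.exchange T ω - χ.exchange (M.τ i ω) ω) := by
    intro i hi
    have hτ : (M.τ i ω : ℝ) ≤ T :=
      NNReal.coe_le_coe.2 (((M.lt_N_iff _ ω i).1 (Finset.mem_range.1 hi)).trans hρ)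
    have hsub : ∀ c d : ℝ, c ∈ Icc (0 : ℝ) T → d ∈ Icc (0 : ℝ) T →
        IntervalIntegrable (fun t : ℝ => χ.ξ t.toNNReal ω) volume c d :=
      fun c d hc hd => hξ.mono_set (by
        rw [uIcc_of_le (NNReal.coe_nonneg T)]
        exact uIcc_subset_Icc hc hd)
    have m0 : (0 : ℝ) ∈ Icc (0 : ℝ) T := ⟨le_rfl, NNReal.coe_nonneg _⟩
    have mT : (T : ℝ) ∈ Icc (0 : ℝ) T := ⟨NNReal.coe_nonneg _, le_rfl⟩
    have mτ : (M.τ i ω : ℝ) ∈ Icc (0 : ℝ) T := ⟨NNReal.coe_nonneg _, hτ⟩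
    refine ⟨IntervalIntegrable.const_mul ⟨hξ.1.indicator measurableSet_Ici,
      hξ.2.indicator measurableSet_Ici⟩ _, ?_⟩
    rw [intervalIntegral.integral_const_mul, Strategy.exchange, Strategy.exchange,
      intervalIntegral.integral_interval_sub_left (hsub _ _ m0 mT) (hsub _ _ m0 mτ),
      intervalIntegral.integral_of_le (NNReal.coe_nonneg T), intervalIntegral.integral_of_le hτ,
      setIntegral_indicator measurableSet_Ici]
    congr 1
    refine setIntegral_congr_set ?_
    have : Ioc (0 : ℝ) T ∩ Ici (M.τ i ω : ℝ) = Icc (M.τ i ω : ℝ) T := by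
      have := NNReal.coe_pos.2 (M.τ_pos' i ω)
      ext t
      simp only [mem_inter_iff, mem_Ioc, mem_Ici, mem_Icc]
      exact ⟨fun h => ⟨h.2, h.1.2⟩, fun h => ⟨⟨this.trans_le h.1, h.2⟩, h.1⟩⟩
    rw [this]
    exact Ioc_ae_eq_Icc.symm
  rw [← Finset.sum_congr rfl fun i hi => (hterm i hi).2,
    ← intervalIntegral.integral_finsetSum fun i hi => (hterm i hi).1]
  refine intervalIntegral.integral_congr fun t ht => ?_
  rw [uIcc_of_le (NNReal.coe_nonneg T)] at ht
  rw [M.Z_eq_sum χ.Xhat χ.Xi (min_le_left (χ.ρ ω) t.toNNReal) ω, Finset.sum_mul]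
  refine Finset.sum_congr rfl fun i hi => ?_
  have hi' := (M.lt_N_iff _ ω i).1 (Finset.mem_range.1 hi)
  have : M.τ i ω ≤ min (χ.ρ ω) t.toNNReal ↔ t ∈ Ici (M.τ i ω : ℝ) := by
    rw [le_min_iff, mem_Ici, Real.le_toNNReal_iff_coe_le ht.1]
    exact and_iff_right hi'
  by_cases h : t ∈ Ici (M.τ i ω : ℝ)
  · rw [if_pos (this.2 h), indicator_of_mem h]; ring
  · rw [if_neg fun h' => h (this.1 h'), indicator_of_notMem h]; ring

lemma cost_eq (hβ : M.β = 0) (hκ : M.κ = 0) (hh : M.h = fun x => η * x) (hT : 0 < T)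
    (hρ : χ.ρ ω ≤ T) (hξ : IntervalIntegrable (fun t : ℝ => χ.ξ t.toNNReal ω) volume 0 T)
    (hξ2 : IntervalIntegrable (fun t : ℝ => χ.ξ t.toNNReal ω ^ 2) volume 0 T)
    (hliq : χ.exchange T ω + M.Z χ.Xhat χ.Xi (χ.ρ ω) ω = 0) :
    M.cost 0 T χ ω = M.unaffectedCost χ T ω + M.impactCost χ η T ω := by
  have hA := intervalIntegrable_mul_cadlag (M.P0_cadlag ω) hT hξ
  have hB := (Strategy.intervalIntegrable_mul_exchange hξ).const_mul M.γ
  have h1 : ∫ t in (0 : ℝ)..T, χ.ξ t.toNNReal ω * M.exchangePrice χ t ω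
      = (∫ t in (0 : ℝ)..T, χ.ξ t.toNNReal ω * M.P0 t.toNNReal ω)
        + M.γ * (χ.exchange T ω ^ 2 / 2) + η * ∫ t in (0 : ℝ)..T, χ.ξ t.toNNReal ω ^ 2 := by
    simp only [M.mul_exchangePrice_eq hh]
    rw [intervalIntegral.integral_add (hA.add hB) (hξ2.const_mul η),
      intervalIntegral.integral_add hA hB, intervalIntegral.integral_const_mul,
      intervalIntegral.integral_const_mul]
    congr 3
    exact integral_mul_primitive hξ
  have h2 := sum_mul_sum_range (fun i => M.Y χ.Xhat χ.Xi i ω) (M.N (χ.ρ ω) ω)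
  have hz : χ.exchange T ω = -∑ i ∈ Finset.range (M.N (χ.ρ ω) ω), M.Y χ.Xhat χ.Xi i ω :=
    eq_neg_of_add_eq_zero_left hliq
  have h3 : ∑ i ∈ Finset.range (M.N (χ.ρ ω) ω), M.Y χ.Xhat χ.Xi i ω *
      (χ.exchange T ω - χ.exchange (M.τ i ω) ω)
      = (∑ i ∈ Finset.range (M.N (χ.ρ ω) ω), M.Y χ.Xhat χ.Xi i ω) * χ.exchange T ω
        - ∑ i ∈ Finset.range (M.N (χ.ρ ω) ω), M.Y χ.Xhat χ.Xi i ω * χ.exchange (M.τ i ω) ω := by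
    rw [Finset.sum_mul, ← Finset.sum_sub_distrib]
    exact Finset.sum_congr rfl fun i _ => by ring
  have h4 : ∑ i ∈ Finset.range (M.N (χ.ρ ω) ω), M.Y χ.Xhat χ.Xi i ω * (M.darkPrice χ i ω
        + M.α * M.γ * (∑ j ∈ Finset.range i, M.Y χ.Xhat χ.Xi j ω) + M.β (M.Y χ.Xhat χ.Xi i ω))
      = ∑ i ∈ Finset.range (M.N (χ.ρ ω) ω), M.Y χ.Xhat χ.Xi i ω * M.P0 (M.τ i ω) ω
        + M.γ * ∑ i ∈ Finset.range (M.N (χ.ρ ω) ω),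
          M.Y χ.Xhat χ.Xi i ω * χ.exchange (M.τ i ω) ω
        + M.α * M.γ * ∑ i ∈ Finset.range (M.N (χ.ρ ω) ω), M.Y χ.Xhat χ.Xi i ω *
          ∑ j ∈ Finset.range i, M.Y χ.Xhat χ.Xi j ω := by
    rw [Finset.mul_sum, Finset.mul_sum, ← Finset.sum_add_distrib, ← Finset.sum_add_distrib]
    refine Finset.sum_congr rfl fun i _ => ?_
    rw [darkPrice, hκ, hβ, Pi.zero_apply]
    ring
  rw [cost, h1, M.integral_Z_mul hρ hξ, h3, h4, h2, unaffectedCost, impactCost, Z, hz]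
  ring

lemma impactCost_nonneg (hη : 0 < η) (hT : 0 < T) (hTη : M.γ * T ≤ 2 * η) (hρ : χ.ρ ω ≤ T)
    (hξ : IntervalIntegrable (fun t : ℝ => χ.ξ t.toNNReal ω) volume 0 T)
    (hξ2 : IntervalIntegrable (fun t : ℝ => χ.ξ t.toNNReal ω ^ 2) volume 0 T)
    (hliq : χ.exchange T ω + M.Z χ.Xhat χ.Xi (χ.ρ ω) ω = 0) :
    0 ≤ M.impactCost χ η T ω := by
  have hγ := M.γ_pos
  have hT' : (0 : ℝ) < T := NNReal.coe_pos.2 hT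
  obtain ⟨hα0, hα1⟩ := M.α_mem
  set S := ∫ t in (0 : ℝ)..T, χ.ξ t.toNNReal ω ^ 2 with hS
  set n := M.N (χ.ρ ω) ω with hn
  set Y : ℕ → ℝ := fun i => M.Y χ.Xhat χ.Xi i ω with hY
  set z := ∑ i ∈ Finset.range n, Y i with hz
  have hzZ : M.Z χ.Xhat χ.Xi (χ.ρ ω) ω = z := rfl
  have hxT : χ.exchange T ω = -z := eq_neg_of_add_eq_zero_left hliq
  set F : ℕ → ℝ := fun i => M.filled χ.Xhat χ.Xi (i + 1) ω - M.filled χ.Xhat χ.Xi i ω with hF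
  have hF0 : ∀ i, 0 ≤ F i := fun i => sub_nonneg.2 (M.filled_monotone _ _ ω i.le_succ)
  have hsub : ∀ c d : ℝ, c ∈ Icc (0 : ℝ) T → d ∈ Icc (0 : ℝ) T → uIcc c d ⊆ uIcc 0 (T : ℝ) :=
    fun c d hc hd => by
      rw [uIcc_of_le (NNReal.coe_nonneg T)]
      exact uIcc_subset_Icc hc hd
  have m0 : (0 : ℝ) ∈ Icc (0 : ℝ) T := ⟨le_rfl, hT'.le⟩
  have mT : (T : ℝ) ∈ Icc (0 : ℝ) T := ⟨hT'.le, le_rfl⟩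
  -- Cauchy–Schwarz on [0,u] and on [u,T], where the exchange trades sum to x_u and to -z - x_u;
  -- both lengths are at most T.
  have hu : ∀ u ∈ Icc (0 : ℝ) T, χ.exchange u ω ^ 2 + (z + χ.exchange u ω) ^ 2 ≤ T * S := by
    intro u hu
    have a1 := sq_integral_le hu.1 (hξ.mono_set (hsub _ _ m0 hu)) (hξ2.mono_set (hsub _ _ m0 hu))
    have a2 := sq_integral_le hu.2 (hξ.mono_set (hsub _ _ hu mT)) (hξ2.mono_set (hsub _ _ hu mT))
    have e1 : ∫ t in u..T, χ.ξ t.toNNReal ω = χ.exchange T ω - χ.exchange u ω :=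
      (intervalIntegral.integral_interval_sub_left (hξ.mono_set (hsub _ _ m0 mT))
        (hξ.mono_set (hsub _ _ m0 hu))).symm
    have e2 := intervalIntegral.integral_add_adjacent_intervals
      (hξ2.mono_set (hsub _ _ m0 hu)) (hξ2.mono_set (hsub _ _ hu mT))
    have p1 : 0 ≤ ∫ t in (0 : ℝ)..u, χ.ξ t.toNNReal ω ^ 2 :=
      intervalIntegral.integral_nonneg hu.1 fun t _ => sq_nonneg _
    have p2 : 0 ≤ ∫ t in u..T, χ.ξ t.toNNReal ω ^ 2 :=
      intervalIntegral.integral_nonneg hu.2 fun t _ => sq_nonneg _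
    rw [e1, hxT] at a2
    change χ.exchange u ω ^ 2 ≤ _ at a1
    rw [hS, ← e2]
    nlinarith [mul_nonneg hu.1 p2, mul_nonneg (sub_nonneg.2 hu.2) p1]
  have hS0 : 0 ≤ S := intervalIntegral.integral_nonneg hT'.le fun t _ => sq_nonneg _
  have hSγ : M.γ * (T * S) ≤ 2 * (η * S) := by nlinarith [mul_le_mul_of_nonneg_right hTη hS0]
  have hzS : z ^ 2 ≤ T * S := by
    have := hu T mT
    rw [hxT] at this
    nlinarith
  have hYF : ∀ i, Y i = Real.sign χ.Xhat * F i := fun i => rfl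
  have hsgn : ∀ i j, 0 ≤ Y i * Y j := fun i j => by
    rw [hYF, hYF]
    nlinarith [mul_nonneg (mul_self_nonneg (Real.sign χ.Xhat)) (mul_nonneg (hF0 i) (hF0 j))]
  have hzY : ∀ i, 0 ≤ z * Y i := fun i => by
    rw [hz, Finset.sum_mul]
    exact Finset.sum_nonneg fun j _ => hsgn j i
  have hsq : ∑ i ∈ Finset.range n, Y i ^ 2 ≤ z ^ 2 := by
    have := sum_mul_sum_range Y n
    have h0 : 0 ≤ ∑ i ∈ Finset.range n, Y i * ∑ j ∈ Finset.range i, Y j :=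
      Finset.sum_nonneg fun i _ => by
        rw [Finset.mul_sum]; exact Finset.sum_nonneg fun j _ => hsgn i j
    linarith
  have hB1 : 0 ≤ η * S - M.γ / 2 * ∑ i ∈ Finset.range n, Y i ^ 2 := by nlinarith
  have hB0 : 0 ≤ η * S + (M.γ / 2 * z ^ 2
      + M.γ * ∑ i ∈ Finset.range n, Y i * χ.exchange (M.τ i ω) ω) := by
    set W := ∑ i ∈ Finset.range n, Y i * χ.exchange (M.τ i ω) ω with hW
    -- The weights z·Y_i are nonnegative and sum to z². With x = x_{τ_i} and ηS ≥ (γ/2)(x² +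
    -- (z+x)²), the second factor is at least γ(z+x)².
    have hterm : ∀ i ∈ Finset.range n,
        0 ≤ (z * Y i) * (η * S + M.γ / 2 * z ^ 2 + M.γ * z * χ.exchange (M.τ i ω) ω) := by
      intro i hi
      refine mul_nonneg (hzY i) ?_
      have hτ : (M.τ i ω : ℝ) ≤ T :=
        NNReal.coe_le_coe.2 (((M.lt_N_iff _ ω i).1 (Finset.mem_range.1 hi)).trans hρ)
      have := hu _ ⟨NNReal.coe_nonneg _, hτ⟩
      nlinarith [mul_le_mul_of_nonneg_left this hγ.le,
        mul_nonneg hγ.le (sq_nonneg (z + χ.exchange (M.τ i ω) ω))]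
    have hsum := Finset.sum_nonneg hterm
    have e : ∑ i ∈ Finset.range n,
        (z * Y i) * (η * S + M.γ / 2 * z ^ 2 + M.γ * z * χ.exchange (M.τ i ω) ω)
        = z ^ 2 * (η * S + (M.γ / 2 * z ^ 2 + M.γ * W)) := by
      have e1 : ∀ i, (z * Y i) * (η * S + M.γ / 2 * z ^ 2 + M.γ * z * χ.exchange (M.τ i ω) ω)
          = z * (η * S + M.γ / 2 * z ^ 2) * Y i
            + z ^ 2 * M.γ * (Y i * χ.exchange (M.τ i ω) ω) := fun i => by ring
      simp only [e1]
      rw [Finset.sum_add_distrib, ← Finset.mul_sum, ← Finset.mul_sum]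
      ring
    rw [e] at hsum
    -- If z = 0 the weights carry no information, but then every Y_i vanishes because they share a
    -- sign.
    rcases eq_or_ne z 0 with h0 | h0
    · have hYi : ∀ i ∈ Finset.range n, Y i = 0 := by
        intro i hi
        have : Y i ^ 2 ≤ 0 := (Finset.single_le_sum (f := fun i => Y i ^ 2)
          (fun i _ => sq_nonneg _) hi).trans (hsq.trans (by rw [h0]; norm_num))
        exact pow_eq_zero_iff two_ne_zero |>.1 (le_antisymm this (sq_nonneg _))
      have hW0 : W = 0 := Finset.sum_eq_zero fun i hi => by rw [hYi i hi, zero_mul]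
      rw [hW0, h0]
      simp only [ne_eq, OfNat.ofNat_ne_zero, not_false_eq_true, zero_pow, mul_zero, add_zero]
      exact mul_nonneg hη.le hS0
    · exact nonneg_of_mul_nonneg_right hsum (by positivity)
  have : M.impactCost χ η T ω = (1 - M.α) * (η * S + (M.γ / 2 * z ^ 2
      + M.γ * ∑ i ∈ Finset.range n, Y i * χ.exchange (M.τ i ω) ω))
      + M.α * (η * S - M.γ / 2 * ∑ i ∈ Finset.range n, Y i ^ 2) := by
    rw [impactCost, hzZ]
    ring
  rw [this]
  exact add_nonneg (mul_nonneg (by linarith) hB0) (mul_nonneg hα0 hB1)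

/-- The costs dominate A, so E C⁻ ≤ E A⁻ = E A⁺ ≤ E C⁺, also when these are infinite. -/
lemma not_hasPriceManipulation [IsProbabilityMeasure P] (hP0 : M.P0MartingaleEnlarged)
    (hβ : M.β = 0) (hκ : M.κ = 0) (hh : M.h = fun x => η * x) (hη : 0 < η) (hT : 0 < T)
    (hTη : M.γ * T ≤ 2 * η) : ¬ M.HasPriceManipulation T := by
  rintro ⟨χ, hχ, hint, hlt⟩
  have hle : ∀ᵐ ω ∂P, M.unaffectedCost χ T ω ≤ M.cost 0 T χ ω := by
    filter_upwards [hint, hχ.ρ_lt, hχ.ξ_integrable, hχ.liquidation] with ω h1 h2 h3 h4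
    have hρ : χ.ρ ω ≤ T := NNReal.coe_le_coe.1 h2.le
    rw [zero_add] at h4
    have h5 := (M.intervalIntegrable_sq_iff hh hη.ne' hT h3).1 h1
    rw [M.cost_eq hβ hκ hh hT hρ h3 h5 h4]
    exact le_add_of_nonneg_right (M.impactCost_nonneg hη hT hTη hρ h3 h5 h4)
  refine absurd hlt (not_lt.2 ?_)
  calc ∫⁻ ω, ENNReal.ofReal (-M.cost 0 T χ ω) ∂P
      ≤ ∫⁻ ω, ENNReal.ofReal (-M.unaffectedCost χ T ω) ∂P :=
        lintegral_mono_ae (hle.mono fun ω h => ENNReal.ofReal_le_ofReal (neg_le_neg h))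
    _ = ∫⁻ ω, ENNReal.ofReal (M.unaffectedCost χ T ω) ∂P :=
        (IsAdmissible.lintegral_unaffectedCost M hP0 hT hχ).symm
    _ ≤ _ := lintegral_mono_ae (hle.mono fun ω h => ENNReal.ofReal_le_ofReal h)

end Model

lemma abs_truncate_sub_le (C a b : ℝ) :
    |max (-C) (min C a) - max (-C) (min C b)| ≤ |a - b| := by
  rw [max_comm (-C), max_comm (-C)]
  exact (abs_max_sub_max_le_abs _ _ _).trans (by simpa using abs_min_sub_min_le_max C a C b)

namespace Model

variable {Ω : Type*} [MeasurableSpace Ω] {P : Measure Ω} (M : Model P)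

/-! ### The all-or-nothing order of one share -/

section Unit

lemma filled_one_eq (n : ℕ) (ω : Ω) : M.filled 1 1 n ω = 0 ∨ M.filled 1 1 n ω = 1 := by
  induction n with
  | zero => exact Or.inl rfl
  | succ n ih =>
    simp only [filled]
    split_ifs with h
    · rcases ih with ih | ih <;> rw [ih]
      · right
        rw [abs_one, sub_zero, min_eq_right h]
        simp
      · right
        simp
    · simpa using ih

lemma Z_one_eq_filled (t : ℝ≥0) (ω : Ω) : M.Z 1 1 t ω = M.filled 1 1 (M.N t ω) ω := by
  rw [Z_eq, Real.sign_one, one_mul]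

lemma Z_one_eq (t : ℝ≥0) (ω : Ω) : M.Z 1 1 t ω = 0 ∨ M.Z 1 1 t ω = 1 := by
  rw [Z_one_eq_filled]
  exact M.filled_one_eq _ _

lemma Z_one_mem (t : ℝ≥0) (ω : Ω) : M.Z 1 1 t ω ∈ Icc (0 : ℝ) 1 := by
  rcases M.Z_one_eq t ω with h | h <;> rw [h] <;> simp

lemma sum_sq_Y_one (t : ℝ≥0) (ω : Ω) :
    ∑ i ∈ Finset.range (M.N t ω), M.Y 1 1 i ω ^ 2 = M.Z 1 1 t ω := by
  refine Finset.sum_congr rfl fun i _ => ?_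
  have hm : M.filled 1 1 i ω ≤ M.filled 1 1 (i + 1) ω := M.filled_monotone 1 1 ω i.le_succ
  rw [Y, Real.sign_one, one_mul]
  rcases M.filled_one_eq i ω with h | h <;> rcases M.filled_one_eq (i + 1) ω with h' | h' <;>
    rw [h, h'] at hm ⊢
  · norm_num
  · norm_num
  · norm_num at hm
  · norm_num

lemma Z_one_eq_one {t : ℝ≥0} {ω : Ω} (hN : 1 ≤ M.N t ω) (hY : 1 ≤ M.Ytil 0 ω) :
    M.Z 1 1 t ω = 1 := by
  have h1 : M.filled 1 1 1 ω = 1 := by simp [filled, hY]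
  have h2 : M.filled 1 1 1 ω ≤ M.filled 1 1 (M.N t ω) ω := M.filled_monotone 1 1 ω hN
  rw [Z_one_eq_filled]
  rcases M.filled_one_eq (M.N t ω) ω with h | h
  · rw [h, h1] at h2; norm_num at h2
  · exact h

/-- With positive probability an order arrives by time t and the first one has size at least 1; the
two events are independent. -/
lemma integral_Z_one_pos [IsProbabilityMeasure P] {θ : ℝ≥0} {μ : Measure ℝ≥0∞}
    (hN : M.PoissonArrivals θ μ) {t : ℝ≥0} (ht : 0 < t) : 0 < ∫ ω, M.Z 1 1 t ω ∂P := by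
  set E : Set Ω := {ω | 1 ≤ M.N t ω} ∩ {ω | 1 ≤ M.Ytil 0 ω} with hE
  have hNm : MeasurableSet {ω | 1 ≤ M.N t ω} := measurableSet_le measurable_const (M.measurable_N t)
  have hYm : MeasurableSet {ω | 1 ≤ M.Ytil 0 ω} :=
    measurableSet_le measurable_const (M.Ytil_measurable 0)
  have hPN : P {ω | 1 ≤ M.N t ω} ≠ 0 := by
    have h1 := hN.poisson.increment_law 0 t zero_le
    have hm : Measurable fun ω => M.N t ω - M.N 0 ω := (M.measurable_N t).sub (M.measurable_N 0)
    have h2 : 0 < poissonMeasure (θ * (t - 0)) {1} := by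
      rw [poissonMeasure_singleton]
      have : 0 < θ * (t - 0) := by rw [tsub_zero]; exact mul_pos hN.θ_pos ht
      positivity
    rw [← h1, Measure.map_apply hm (measurableSet_singleton 1)] at h2
    refine (h2.trans_le (measure_mono fun ω hω => ?_)).ne'
    have : M.N t ω - M.N 0 ω = 1 := hω
    change 1 ≤ M.N t ω
    omega
  have hPY : P {ω | 1 ≤ M.Ytil 0 ω} ≠ 0 := by
    have h1 := hN.μ_tail 1 one_pos
    rw [← hN.Ytil_law 0, Measure.map_apply (M.Ytil_measurable 0) measurableSet_Ici,
      ENNReal.ofReal_one] at h1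
    exact h1.ne'
  have hPE : P E ≠ 0 := by
    have hind := hN.indep.indep (i := 1) (j := 2) (by decide)
    have h1 := (Indep_iff _ _ P).1 hind {ω | 1 ≤ M.N t ω} {ω | 1 ≤ M.Ytil 0 ω}
      (le_iSup (fun t => MeasurableSpace.comap (M.N t) inferInstance) t _
        ⟨Ici 1, measurableSet_Ici, rfl⟩)
      (le_iSup (fun i => MeasurableSpace.comap (M.Ytil i) inferInstance) 0 _
        ⟨Ici 1, measurableSet_Ici, rfl⟩)
    rw [hE, h1]
    exact mul_ne_zero hPN hPY
  have hZi : Integrable (M.Z 1 1 t) P :=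
    Integrable.mono' (integrable_const (1 : ℝ)) (M.measurable_Z 1 1 t).aestronglyMeasurable
      (ae_of_all _ fun ω => by
        obtain ⟨h0, h1⟩ := M.Z_one_mem t ω
        rw [Real.norm_eq_abs, abs_of_nonneg h0]; exact h1)
  rw [integral_pos_iff_support_of_nonneg (fun ω => (M.Z_one_mem t ω).1) hZi]
  refine (pos_iff_ne_zero.2 hPE).trans_le (measure_mono fun ω hω => ?_)
  rw [Function.mem_support, M.Z_one_eq_one hω.1 hω.2]
  exact one_ne_zero

end Unit

/-! ### The manipulation strategy for long horizons -/

section Wait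

variable (δ T : ℝ≥0)

/-- Place an order of one share in the dark pool that can only be filled completely, cancel it at
time `δ`, and sell what has been bought at a constant rate during `(δ, T]`. -/
def waitAndSell : Strategy Ω where
  Xhat := 1
  Xi := 1
  ξ := fun t ω => (Ioi δ).indicator (fun _ => -M.Z 1 1 δ ω / (T - δ)) t
  ρ := fun _ => δ

variable {δ T}

lemma waitAndSell_ξ (t : ℝ) (ω : Ω) : (M.waitAndSell δ T).ξ t.toNNReal ω
    = (Ioi (δ : ℝ)).indicator (fun _ => -M.Z 1 1 δ ω / (T - δ)) t := by
  simp only [waitAndSell, indicator, mem_Ioi, Real.lt_toNNReal_iff_coe_lt]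

lemma integral_indicator_Ioi (c : ℝ) {t : ℝ} (ht : 0 ≤ t) :
    ∫ s in (0 : ℝ)..t, (Ioi (δ : ℝ)).indicator (fun _ => c) s = c * max (t - δ) 0 := by
  rw [intervalIntegral.integral_of_le ht, setIntegral_indicator measurableSet_Ioi,
    Ioc_inter_Ioi, setIntegral_const, smul_eq_mul, max_eq_right (NNReal.coe_nonneg δ),
    Real.volume_real_Ioc]
  exact mul_comm _ _

lemma intervalIntegrable_indicator_Ioi (c a b : ℝ) :
    IntervalIntegrable ((Ioi (δ : ℝ)).indicator fun _ => c) volume a b :=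
  ⟨intervalIntegrable_const.1.indicator measurableSet_Ioi,
    intervalIntegrable_const.2.indicator measurableSet_Ioi⟩

lemma waitAndSell_exchange {t : ℝ} (ht : 0 ≤ t) (ω : Ω) :
    (M.waitAndSell δ T).exchange t ω = -(M.Z 1 1 δ ω * (max (t - δ) 0 / (T - δ))) := by
  simp only [Strategy.exchange, waitAndSell_ξ]
  rw [integral_indicator_Ioi _ ht]
  ring

lemma waitAndSell_exchange_last (hδT : δ < T) (ω : Ω) :
    (M.waitAndSell δ T).exchange T ω = -M.Z 1 1 δ ω := by
  have h : (0 : ℝ) < T - δ := sub_pos.2 (NNReal.coe_lt_coe.2 hδT)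
  rw [M.waitAndSell_exchange (NNReal.coe_nonneg T), max_eq_left h.le, div_self h.ne', mul_one]

lemma waitAndSell_exchange_anti (hδT : δ < T) {s t : ℝ} (hs : 0 ≤ s) (hst : s ≤ t) (ω : Ω) :
    (M.waitAndSell δ T).exchange t ω ≤ (M.waitAndSell δ T).exchange s ω := by
  have h : (0 : ℝ) < T - δ := sub_pos.2 (NNReal.coe_lt_coe.2 hδT)
  rw [M.waitAndSell_exchange hs, M.waitAndSell_exchange (hs.trans hst)]
  refine neg_le_neg (mul_le_mul_of_nonneg_left ?_ (M.Z_one_mem δ ω).1)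
  gcongr

lemma abs_waitAndSell_exchange_le (hδT : δ < T) {t : ℝ} (ht : t ∈ Icc (0 : ℝ) T) (ω : Ω) :
    |(M.waitAndSell δ T).exchange t ω| ≤ 1 := by
  have h1 := M.waitAndSell_exchange_anti hδT ht.1 ht.2 ω
  have h2 := M.waitAndSell_exchange_anti hδT le_rfl ht.1 ω
  have h3 : (M.waitAndSell δ T).exchange 0 ω = 0 := by simp [Strategy.exchange]
  rw [M.waitAndSell_exchange_last hδT] at h1
  have h4 := M.Z_one_mem δ ω
  exact abs_le.2 ⟨by linarith [h4.2], by linarith⟩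

lemma waitAndSell_predictable :
    IsStronglyPredictable (M.𝒢 1 1) (M.waitAndSell δ T).ξ := by
  refine Measurable.stronglyMeasurable fun B hB => ?_
  have hq : Measurable[M.𝒢 1 1 δ] fun ω => -M.Z 1 1 δ ω / ((T : ℝ) - δ) :=
    (M.measurable_Z_𝒢 1 1 δ).neg.div_const _
  -- Off the value 0 the preimage is a rectangle (δ,∞) × A with A known at time δ; sets containing 0
  -- are handled by complements.
  have hset : ∀ B : Set ℝ, MeasurableSet B → (0 : ℝ) ∉ B → MeasurableSet[(M.𝒢 1 1).predictable]
      (Function.uncurry (M.waitAndSell δ T).ξ ⁻¹' B) := by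
    intro B hB h0
    have : Function.uncurry (M.waitAndSell δ T).ξ ⁻¹' B
        = Ioi δ ×ˢ ((fun ω => -M.Z 1 1 δ ω / ((T : ℝ) - δ)) ⁻¹' B) := by
      ext ⟨t, ω⟩
      simp only [mem_preimage, Function.uncurry, waitAndSell, mem_prod]
      by_cases ht : t ∈ Ioi δ
      · simp [ht]
      · simp [ht, h0]
    rw [this]
    exact measurableSet_predictable_Ioi_prod (hq hB)
  by_cases h0 : (0 : ℝ) ∈ B
  · rw [← compl_compl B, preimage_compl]
    exact (hset Bᶜ hB.compl (by simpa using h0)).compl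
  · exact hset B hB h0

lemma waitAndSell_isAdmissible (hδT : δ < T) : M.IsAdmissible 0 T (M.waitAndSell δ T) where
  Xi_nonneg := zero_le_one
  Xi_le := (abs_one (α := ℝ)).ge
  ρ_stopping := isStoppingTime_const _ δ
  ρ_lt := ae_of_all _ fun _ => NNReal.coe_lt_coe.2 hδT
  ξ_predictable := M.waitAndSell_predictable
  ξ_integrable := ae_of_all _ fun ω => by
    simp only [waitAndSell_ξ]
    exact intervalIntegrable_indicator_Ioi _ _ _
  exchange_bounded := ⟨1, ae_of_all _ fun ω t ht => M.abs_waitAndSell_exchange_le hδT ht ω⟩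
  liquidation := ae_of_all _ fun ω => by
    rw [M.waitAndSell_exchange_last hδT, zero_add]
    exact neg_add_cancel _

/-- The exchange part decreases from 0 to -Z_δ ≥ -1 and truncation is 1-Lipschitz; the dark part has
variation at most 1. -/
lemma sum_abs_gridPosition_waitAndSell_le (hδT : δ < T) (n : ℕ) (ω : Ω) :
    ∑ k ∈ Finset.range (n + 1), |M.gridPosition (M.waitAndSell δ T) T 1 n (k + 1) ω
      - M.gridPosition (M.waitAndSell δ T) T 1 n k ω| ≤ 2 := by
  set χ : Strategy Ω := M.waitAndSell δ T with hχ
  have h1 : ∀ k, |M.gridPosition χ T 1 n (k + 1) ω - M.gridPosition χ T 1 n k ω|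
      ≤ (χ.exchange (gridTime T n k) ω - χ.exchange (gridTime T n (k + 1)) ω)
        + |M.gridDark χ T n (k + 1) ω - M.gridDark χ T n k ω| := by
    intro k
    rw [gridPosition, gridPosition, add_sub_add_comm]
    refine (abs_add_le _ _).trans (add_le_add ((abs_truncate_sub_le _ _ _).trans ?_) le_rfl)
    rw [abs_sub_comm, abs_of_nonneg]
    exact sub_nonneg.2 (M.waitAndSell_exchange_anti hδT (NNReal.coe_nonneg _)
      (NNReal.coe_le_coe.2 (gridTime_monotone T n k.le_succ)) ω)
  have h2 := M.sum_abs_gridDark_le χ T n (n + 1) ω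
  have h3 : |χ.Xhat| = 1 := abs_one
  refine (Finset.sum_le_sum fun k _ => h1 k).trans ?_
  rw [Finset.sum_add_distrib, Finset.sum_range_sub' fun k => χ.exchange (gridTime T n k) ω,
    gridTime_last, gridTime_zero, hχ, M.waitAndSell_exchange_last hδT]
  have h4 : (M.waitAndSell δ T).exchange (0 : ℝ≥0) ω = 0 := by simp [Strategy.exchange]
  have h5 := (M.Z_one_mem δ ω).2
  linarith

lemma integrable_unaffectedCost_waitAndSell [IsProbabilityMeasure P]
    (hP0 : M.P0MartingaleEnlarged) (hδT : δ < T) :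
    Integrable (M.unaffectedCost (M.waitAndSell δ T) T) P := by
  have hχ := M.waitAndSell_isAdmissible hδT
  have hT : 0 < T := hδT.trans_le' zero_le
  have hM : Martingale M.P0 (M.𝒢 1 1) P := hP0 1 1 zero_le_one (abs_one (α := ℝ)).ge
  have hb := fun n => integral_abs_sum_le hM (gridTime_monotone T n) (n := n + 1)
    (H := M.gridPosition (M.waitAndSell δ T) T 1 n)
    (fun k => M.measurable_gridPosition (M.waitAndSell δ T) rfl hχ.ξ_predictable hχ.ρ_stopping
      T 1 n k)
    (fun ω => by simp [gridPosition, gridDark, Strategy.exchange])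
    (fun ω => M.sum_abs_gridPosition_waitAndSell_le hδT n ω)
  simp only [gridTime_last] at hb
  have hlim : ∀ᵐ ω ∂P, Tendsto (fun n => M.gridIntegral (M.waitAndSell δ T) T 1 n ω) atTop
      (𝓝 (-M.unaffectedCost (M.waitAndSell δ T) T ω)) := by
    filter_upwards [hχ.ξ_integrable, hχ.liquidation] with ω h1 h2
    rw [zero_add] at h2
    exact M.tendsto_gridIntegral _ hT hδT.le h1
      (fun t ht => M.abs_waitAndSell_exchange_le hδT ht ω) h2
  have h := integrable_of_tendsto_of_integral_abs_le (fun n => (hb n).1) (fun n => (hb n).2) hlim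
  simpa using h.neg

/-- Z_δ takes only the values 0 and 1, so it equals its square and the sum of the squared
executions. -/
lemma impactCost_waitAndSell {η : ℝ} (hα : M.α = 1) (hδT : δ < T) (ω : Ω) :
    M.impactCost (M.waitAndSell δ T) η T ω = -(M.γ / 2 - η / (T - δ)) * M.Z 1 1 δ ω := by
  have h : (0 : ℝ) < T - δ := sub_pos.2 (NNReal.coe_lt_coe.2 hδT)
  have h1 : ∫ t in (0 : ℝ)..T, (M.waitAndSell δ T).ξ t.toNNReal ω ^ 2
      = M.Z 1 1 δ ω / (T - δ) := by
    have e : ∀ t : ℝ, (M.waitAndSell δ T).ξ t.toNNReal ω ^ 2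
        = (Ioi (δ : ℝ)).indicator (fun _ => (-M.Z 1 1 δ ω / (T - δ)) ^ 2) t := by
      intro t
      rw [waitAndSell_ξ]
      by_cases ht : t ∈ Ioi (δ : ℝ)
      · simp only [indicator_of_mem ht]
      · simp only [indicator_of_notMem ht]; norm_num
    simp only [e]
    rw [integral_indicator_Ioi _ (NNReal.coe_nonneg T), max_eq_left h.le]
    rcases M.Z_one_eq δ ω with hz | hz <;> rw [hz]
    · simp
    · field_simp
  have h2 : ∑ i ∈ Finset.range (M.N δ ω), M.Y 1 1 i ω ^ 2 = M.Z 1 1 δ ω := M.sum_sq_Y_one δ ω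
  rw [impactCost, h1, hα]
  simp only [waitAndSell, h2]
  ring

lemma hasPriceManipulation [IsProbabilityMeasure P] (hP0 : M.P0MartingaleEnlarged)
    {θ : ℝ≥0} {μ : Measure ℝ≥0∞} (hN : M.PoissonArrivals θ μ) (hβ : M.β = 0) (hκ : M.κ = 0)
    {η : ℝ} (hh : M.h = fun x => η * x) (hη : η ≠ 0) (hα : M.α = 1) (hδ : 0 < δ) (hδT : δ < T)
    (hc : η / (T - δ) < M.γ / 2) : M.HasPriceManipulation T := by
  have hT : 0 < T := hδ.trans hδT
  set χ : Strategy Ω := M.waitAndSell δ T with hχdef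
  have hχ : M.IsAdmissible 0 T χ := M.waitAndSell_isAdmissible hδT
  have hξ : ∀ ω, IntervalIntegrable (fun t : ℝ => χ.ξ t.toNNReal ω) volume 0 T := fun ω => by
    simp only [hχdef, waitAndSell_ξ]
    exact intervalIntegrable_indicator_Ioi _ _ _
  have hξ2 : ∀ ω, IntervalIntegrable (fun t : ℝ => χ.ξ t.toNNReal ω ^ 2) volume 0 T := fun ω => by
    refine (intervalIntegrable_indicator_Ioi (δ := δ) ((-M.Z 1 1 δ ω / (T - δ)) ^ 2) 0 T).congr
      fun t _ => ?_
    simp only [hχdef, waitAndSell_ξ]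
    by_cases ht : t ∈ Ioi (δ : ℝ)
    · simp only [indicator_of_mem ht]
    · simp only [indicator_of_notMem ht]; norm_num
  have hA := M.integrable_unaffectedCost_waitAndSell hP0 hδT
  have hA0 : ∫ ω, M.unaffectedCost χ T ω ∂P = 0 := by
    -- Integrability turns the equality of positive and negative parts into a vanishing mean.
    rw [integral_eq_lintegral_pos_part_sub_lintegral_neg_part hA,
      IsAdmissible.lintegral_unaffectedCost M hP0 hT hχ, sub_self]
  have hcost : M.cost 0 T χ
      = fun ω => M.unaffectedCost χ T ω + -(M.γ / 2 - η / (T - δ)) * M.Z 1 1 δ ω := by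
    funext ω
    rw [M.cost_eq hβ hκ hh hT hδT.le (hξ ω) (hξ2 ω), M.impactCost_waitAndSell hα hδT]
    rw [hχdef, M.waitAndSell_exchange_last hδT]
    exact neg_add_cancel _
  have hZi : Integrable (M.Z 1 1 δ) P :=
    Integrable.mono' (integrable_const (1 : ℝ)) (M.measurable_Z 1 1 δ).aestronglyMeasurable
      (ae_of_all _ fun ω => by
        obtain ⟨h0, h1⟩ := M.Z_one_mem δ ω
        rw [Real.norm_eq_abs, abs_of_nonneg h0]; exact h1)
  have hCi : Integrable (M.cost 0 T χ) P := by
    rw [hcost]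
    exact hA.add (hZi.const_mul _)
  have hneg : ∫ ω, M.cost 0 T χ ω ∂P < 0 := by
    rw [hcost, integral_add hA (hZi.const_mul _), hA0, integral_const_mul, zero_add]
    exact mul_neg_of_neg_of_pos (by linarith) (M.integral_Z_one_pos hN hδ)
  refine ⟨χ, hχ, ae_of_all _ fun ω => (M.intervalIntegrable_sq_iff hh hη hT (hξ ω)).2 (hξ2 ω), ?_⟩
  rw [integral_eq_lintegral_pos_part_sub_lintegral_neg_part hCi, sub_neg] at hneg
  exact (ENNReal.toReal_lt_toReal hCi.lintegral_lt_top.ne hCi.neg.lintegral_lt_top.ne).1 hneg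

end Wait

end Model

end DarkPool

end

theorem mainTheorem6 {Ω : Type*} [MeasurableSpace Ω] (P : Measure Ω) [IsProbabilityMeasure P]
    (M : DarkPool.Model P) (hP0 : M.P0MartingaleEnlarged)
    (θ : ℝ≥0) (μ : Measure ℝ≥0∞) (hN : M.PoissonArrivals θ μ)
    (hβ : M.β = 0) (hκ : M.κ = 0) (η : ℝ) (hh : M.h = fun x => η * x)
    (T : ℝ) (hT : 0 < T) :
    (T ≤ 2 * η / M.γ → ¬ M.HasPriceManipulation T) ∧
    (M.α = 1 → (¬ M.HasPriceManipulation T ↔ T ≤ 2 * η / M.γ)) := by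
  have hγ := M.γ_pos
  have hη : 0 < η := by
    have h := M.h_impact.strictMono one_pos
    rw [hh] at h
    simpa using h
  lift T to ℝ≥0 using hT.le
  have hT' : 0 < T := NNReal.coe_pos.1 hT
  have hno : (T : ℝ) ≤ 2 * η / M.γ → ¬ M.HasPriceManipulation T := fun h =>
    M.not_hasPriceManipulation hP0 hβ hκ hh hη hT' (by rwa [le_div_iff₀ hγ, mul_comm] at h)
  refine ⟨hno, fun hα => ⟨fun h => ?_, hno⟩⟩
  by_contra! hlt
  have hpos : 0 < 2 * η / M.γ := by positivity
  -- Half of the excess over the critical horizon: then T - δ > 2η/γ, that is, η/(T-δ) < γ/2.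
  obtain ⟨δ, hδ⟩ : ∃ δ : ℝ≥0, (δ : ℝ) = (T - 2 * η / M.γ) / 2 :=
    ⟨_, Real.coe_toNNReal _ (by linarith)⟩
  refine h (M.hasPriceManipulation hP0 hN hβ hκ hh hη.ne' hα (δ := δ) ?_ ?_ ?_)
  · rw [← NNReal.coe_pos, hδ]
    linarith
  · rw [← NNReal.coe_lt_coe, hδ]
    linarith
  · rw [hδ, div_lt_iff₀ (by linarith)]
    have : M.γ / 2 * (2 * η / M.γ) = η := by field_simp
    nlinarith
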